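/- Let $K$ be a number field of degree $d$ over $\mathbb{Q}$. For each place $v$ of $K$ let $K_v$ be the completion of $K$ at $v$, let $d_v$ be its local degree, and let $|\cdot|_v$ be the absolute value on $K_v$ normalized by $|p|_v=p^{-d_v/d}$ if $v$ lies above the prime number $p$, and by $|x|_v=|x|^{d_v/d}$ for $x\in\mathbb{Q}$ if $v$ is Archimedean. For $Q\in K[T]$ let $\|Q\|_v$ be the maximum of the $|\cdot|_v$-absolute values of the coefficients of $Q$, and let $Q^{(j)}$ be the $j$-th derivative of $Q$. Let $n$ and $t$ be integers with $1\le t\le n/4$, and let $k=[n/4]$ be the integral part of $n/4$. Let $w$ be a place of $K$ and let $\xi\in K_w$. There exists a constant $c>0$, depending only on $K$, $n$, $w$ and $\xi$, with the following property. Assume that for each sufficiently large real number $X$ there exists a nonzero polynomial $Q\in K[T]$ of degree at most $n$ such that $\|Q\|_v\le 1$ for each place $v\ne w$ of $K$ and $$\max_{0\le j\le n-t}|Q^{(j)}(\xi)|_w\le c\,X^{-t/(k+1-t)},\qquad \max_{n-t<j\le n}|Q^{(j)}(\xi)|_w\le X.$$ Then $\xi$ is algebraic over $K$, of degree at most $(n-k+1)/(2t)$.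 -/

import Mathlib

open Polynomial
open scoped NumberField

noncomputable section

namespace RoyWaldschmidt

universe u

/-- A place of the number field `K`: an Archimedean place, or an ultrametric place, given by
a nonzero prime ideal of the ring of integers. -/
inductive Place (K : Type u) [Field K] [NumberField K] : Type u
  | arch (v : NumberField.InfinitePlace K) : Place K
  | ultra (v : IsDedekindDomain.HeightOneSpectrum (𝓞 K)) : Place K

namespace Place

variable {K : Type u} [Field K] [NumberField K]

/-- The completion `K_v` of `K` at the place `v`. -/
def Completion : Place K → Type u
  | arch v => v.Completion
  | ultra v => v.adicCompletion K

/-- The normed field structure of `K_v` (with Mathlib's absolute values, not yet normalized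
relatively to `K`). -/
instance instNormedField : (v : Place K) → NormedField v.Completion
  | arch v => inferInstanceAs (NormedField v.Completion)
  | ultra v => inferInstanceAs (NormedField (v.adicCompletion K))

/-- `K_v` is an extension of `K`. -/
instance instAlgebra : (v : Place K) → Algebra K v.Completion
  | arch v => inferInstanceAs (Algebra K v.Completion)
  | ultra v => inferInstanceAs (Algebra K (v.adicCompletion K))

/-- The exponent by which Mathlib's absolute value on `K_v` has to be raised.
With `d = [K : ℚ]` and `d_v` the local degree at `v`:
* at an Archimedean place, Mathlib's absolute value extends the usual one of `ℚ`,
  so the exponent is `d_v / d`, where `d_v` is `1` at a real and `2` at a complex place;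
* at an ultrametric place over a prime `p`, Mathlib's absolute value takes the value
  `N(𝔭)⁻¹` at a uniformizer, thus `p ^ (-d_v)` at `p`, so the exponent is `1 / d`. -/
def normExponent : Place K → ℝ
  | arch v => (v.mult : ℝ) / (Module.finrank ℚ K : ℝ)
  | ultra _ => 1 / (Module.finrank ℚ K : ℝ)

/-- The absolute value `|x|_v` of `x ∈ K_v`, normalized by `|p|_v = p ^ (-d_v / d)` if `v` is
above the prime number `p`, and by `|x|_v = |x| ^ (d_v / d)` for `x ∈ ℚ` if `v` is
Archimedean. -/
def abv (v : Place K) (x : v.Completion) : ℝ :=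
  ‖x‖ ^ v.normExponent

/-- `‖Q‖_v`, the maximum of the `v`-adic absolute values of the coefficients of `Q ∈ K[T]`. -/
def coeffNorm (v : Place K) (Q : K[X]) : ℝ :=
  (Finset.range (Q.natDegree + 1)).sup' Finset.nonempty_range_add_one
    fun i => v.abv (algebraMap K v.Completion (Q.coeff i))

end Place

end RoyWaldschmidt

end

/-! Let d = [K : ℚ], write T for the polynomial variable, and put X = exp((k+1-t)x/d); x is the
scale. Weighting the coefficients of Q by signs and factorials gives a sequence q_0, ..., q_n
(`dualSeq`) whose moment functional sends (T-ξ)^l to (-1)^l l! Q^(n-l)(ξ) (`moment_dualSeq`). So its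
first t moments about ξ may be large, and the others are small. In a (k+1)×(k+1) minor of the Hankel
matrix of q, a unipotent change of columns leaves t large columns and k+1-t small ones. The powers
of X cancel, so for small c the product formula makes all these minors vanish
(`SmallMoments.det_eq_zero`). Hence q satisfies a linear recurrence. If G is the polynomial of one
of least degree r, then r ≤ k and the r×r Hankel determinant D of q is nonzero
(`exists_recurrence`).

Moving along the recurrence relates D to other Hankel minors of q, with Toeplitz determinants of the
coefficients of G as factors (`norm_det_mul_norm_toeplitz`). This bounds D at every place through
the Gauss norm of G. Let h be the height, and let the drop of G be the weighted logarithmic decrease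
of its Gauss norm at w from the unit disk to the disk of radius exp(-V/`w.weight`) around ξ, where V
= (k+1)x/t. The product formula for D and for the leading coefficient of G gives, since n ≥ 4k, the
inequality r x + (2(k+1)/t) h(G) ≤ drop(G) + O(1) (`SmallMoments.le_drop`). Gauss norms are almost
multiplicative, so an irreducible factor p of G satisfies the same inequality
(`SmallMoments.exists_isClose`).

For coprime p, p' of degrees e, e', a Newton polygon estimate of the resultant gives drop(p)
drop(p')/V ≤ e' h(p) + e h(p') + O(1) (`drop_mul_drop_le`). As 2(k+1)/t = 2V/x, the height terms
cancel against those of the previous inequality, and x is bounded (`real_contradiction`). So a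
single p, up to units, serves all large scales. Its drop is unbounded, hence p(ξ) = 0. The root is
simple, so the drop is at most V + O(1), and deg p ≤ (k+1)/t ≤ (n-k+1)/(2t). -/

namespace RoyWaldschmidt

/-! ### Determinants over normed fields -/

section Determinants

/-- A determinant is bounded by the factorial times the product of bounds for its columns. -/
theorem norm_det_le_of_col_le {F : Type*} [NormedField F] {ι : Type*} [Fintype ι] [DecidableEq ι]
    (M : Matrix ι ι F) (R : ι → ℝ) (h : ∀ i j, ‖M i j‖ ≤ R j) :
    ‖M.det‖ ≤ (Fintype.card ι).factorial * ∏ j, R j := by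
  rw [Matrix.det_apply]
  refine (norm_sum_le _ _).trans ?_
  have : ∀ σ ∈ (Finset.univ : Finset (Equiv.Perm ι)),
      ‖Equiv.Perm.sign σ • ∏ i, M (σ i) i‖ ≤ ∏ j, R j := by
    intro σ _
    rw [Units.smul_def, zsmul_eq_mul, norm_mul, norm_prod]
    have h1 : ‖((Equiv.Perm.sign σ : ℤ) : F)‖ = 1 := by
      rcases Int.units_eq_one_or (Equiv.Perm.sign σ) with h | h <;> simp [h]
    rw [h1, one_mul]
    exact Finset.prod_le_prod (fun _ _ => norm_nonneg _) fun i _ => h _ _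
  refine (Finset.sum_le_sum this).trans ?_
  simp [Finset.sum_const, Fintype.card_perm]

theorem norm_sum_le_of_ultrametric {F : Type*} [NormedField F] [IsUltrametricDist F] {ι : Type*}
    (s : Finset ι) (f : ι → F) {C : ℝ} (hC : 0 ≤ C) (h : ∀ i ∈ s, ‖f i‖ ≤ C) :
    ‖∑ i ∈ s, f i‖ ≤ C :=
  IsUltrametricDist.norm_sum_le_of_forall_le_of_nonneg hC h

theorem norm_det_le_of_col_le_of_ultrametric {F : Type*} [NormedField F] [IsUltrametricDist F]
    {ι : Type*} [Fintype ι] [DecidableEq ι]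
    (M : Matrix ι ι F) (R : ι → ℝ) (hR : ∀ j, 0 ≤ R j) (h : ∀ i j, ‖M i j‖ ≤ R j) :
    ‖M.det‖ ≤ ∏ j, R j := by
  rw [Matrix.det_apply]
  refine norm_sum_le_of_ultrametric _ _ (Finset.prod_nonneg fun j _ => hR j) fun σ _ => ?_
  rw [Units.smul_def, zsmul_eq_mul, norm_mul, norm_prod]
  have h1 : ‖((Equiv.Perm.sign σ : ℤ) : F)‖ = 1 := by
    rcases Int.units_eq_one_or (Equiv.Perm.sign σ) with h | h <;> simp [h]
  rw [h1, one_mul]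
  exact Finset.prod_le_prod (fun _ _ => norm_nonneg _) fun i _ => h _ _

theorem norm_det_submatrix_equiv {F : Type*} [NormedField F] {ι κ : Type*} [Fintype ι]
    [DecidableEq ι] [Fintype κ] [DecidableEq κ] (M : Matrix ι κ F) (σ τ : κ ≃ ι) :
    ‖(M.submatrix σ id).det‖ = ‖(M.submatrix τ id).det‖ := by
  have : M.submatrix σ id = (M.submatrix τ id).submatrix (σ.trans τ.symm) id := by
    ext i j; simp
  rw [this, Matrix.det_permute, norm_mul]
  rcases Int.units_eq_one_or (Equiv.Perm.sign (σ.trans τ.symm)) with h | h <;> simp [h]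

/-! ### Hankel and Toeplitz determinants along a linear recurrence. -/

/-- The increasing enumeration of the natural numbers outside `[i, i + q)`. -/
def skip (i q β : ℕ) : ℕ := if β < i then β else β + q

/-- The `q × q` Toeplitz determinant of the sequence `g` with diagonal entry `g i`. -/
def toeplitz {F : Type*} [CommRing F] (g : ℕ → F) (i q : ℕ) : F :=
  (Matrix.of fun a b : Fin q => if (a : ℕ) ≤ i + b then g (i + b - a) else 0).det

/-- The bijection with image `skip i q` on the left and `[i, i + q)` on the right. -/
noncomputable def skipEquiv (r i q : ℕ) (hi : i ≤ r) : Fin r ⊕ Fin q ≃ Fin (r + q) :=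
  Equiv.ofBijective
    (Sum.elim (fun β => ⟨skip i q β, by unfold skip; split_ifs <;> omega⟩)
      (fun b => ⟨i + b, by omega⟩)) (by
    rw [Fintype.bijective_iff_injective_and_card]
    refine ⟨?_, by simp⟩
    rintro (a | a) (b | b) h <;>
      simp only [Sum.elim_inl, Sum.elim_inr, Fin.mk.injEq, skip] at h
    · congr 1; ext; split_ifs at h <;> omega
    · split_ifs at h <;> omega
    · split_ifs at h <;> omega
    · congr 1; ext; omega)

/-- If a sequence satisfies the linear recurrence with coefficients `g`, its determinants on
the columns `skip i q` are determined by those on the first columns. -/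
theorem norm_det_mul_norm_toeplitz {F : Type*} [NormedField F] (a g : ℕ → F) (r i q : ℕ)
    (hi : i ≤ r) (hg : ∀ j, r < j → g j = 0) (x : Fin r → ℕ)
    (h : ∀ α, ∀ s < q, ∑ j ∈ Finset.range (r + 1), g j * a (x α + s + j) = 0) :
    ‖(Matrix.of fun α β : Fin r => a (x α + β)).det‖ * ‖toeplitz g i q‖ =
      ‖g r‖ ^ q * ‖(Matrix.of fun α β : Fin r => a (x α + skip i q β)).det‖ := by
  classical
  -- The product W * Y is block lower triangular: the unit columns of Y select the first r columns
  -- of the sequence, and the recurrence kills the top of its other columns, which are shifts of g.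
  -- Up to sign, W contributes the minor on the columns outside [i, i + q), and Y contributes g_r^q.
  set W : Matrix (Fin r ⊕ Fin q) (Fin (r + q)) F :=
    Matrix.of fun p j => Sum.elim (fun α : Fin r => a (x α + j))
      (fun b : Fin q => if (j : ℕ) = i + b then 1 else 0) p
    with hW
  set Y : Matrix (Fin (r + q)) (Fin r ⊕ Fin q) F :=
    Matrix.of fun j p => Sum.elim (fun β : Fin r => if (j : ℕ) = β then 1 else 0)
      (fun s : Fin q => if (s : ℕ) ≤ j then g (j - s) else 0) p with hY
  have hWσ : W.submatrix id (skipEquiv r i q hi) =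
      Matrix.fromBlocks (Matrix.of fun α β : Fin r => a (x α + skip i q β))
        (Matrix.of fun (α : Fin r) (b : Fin q) => a (x α + (i + b))) 0 1 := by
    ext p p'
    rcases p with α | b <;> rcases p' with β | b'
    · simp [hW, skipEquiv]
    · simp [hW, skipEquiv]
    · simp only [hW, skipEquiv, skip, Matrix.submatrix_apply, Matrix.of_apply, Sum.elim_inr,
        Equiv.ofBijective_apply, Sum.elim_inl, Matrix.fromBlocks_apply₂₁, Matrix.zero_apply, id_eq]
      have := b.2
      split_ifs <;> first | rfl | omega
    · simp [hW, skipEquiv, Matrix.one_apply, Fin.ext_iff, eq_comm]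
  have hYτ : Y.submatrix finSumFinEquiv id =
      Matrix.fromBlocks (1 : Matrix (Fin r) (Fin r) F)
        (Matrix.of fun (β : Fin r) (s : Fin q) => if (s : ℕ) ≤ β then g (β - s) else 0) 0
        (Matrix.of fun (s' s : Fin q) => if (s : ℕ) ≤ r + s' then g (r + s' - s) else 0) := by
    ext p p'
    rcases p with β | s' <;> rcases p' with β' | s
    · simp [hY, Matrix.one_apply, Fin.ext_iff]
    · simp [hY]
    · simp [hY]; omega
    · simp [hY]
  have hU : (Matrix.of fun (s' s : Fin q) =>
      if (s : ℕ) ≤ r + s' then g (r + s' - s) else 0).det = g r ^ q := by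
    rw [Matrix.det_of_isUpperTriangular]
    · simp
    · intro s' s hss
      have : (s : ℕ) < s' := hss
      simp only [Matrix.of_apply]
      rw [if_pos (by omega), hg _ (by omega)]
  have hWY : W * Y = Matrix.fromBlocks (Matrix.of fun α β : Fin r => a (x α + β)) 0
      ((W * Y).toBlocks₂₁)
      (Matrix.of fun a b : Fin q => if (a : ℕ) ≤ i + b then g (i + b - a) else 0).transpose := by
    ext p p'
    rcases p with α | b <;> rcases p' with β | s
    · simp only [hW, hY, Matrix.mul_apply, Matrix.of_apply, Sum.elim_inl, Matrix.fromBlocks_apply₁₁]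
      rw [Finset.sum_eq_single (Fin.castAdd q β)]
      · simp
      · intro j _ hj
        rw [if_neg, mul_zero]
        intro h'; exact hj (Fin.ext (by simpa using h'))
      · simp
    · simp only [hW, hY, Matrix.mul_apply, Matrix.of_apply, Sum.elim_inl, Sum.elim_inr,
        Matrix.fromBlocks_apply₁₂, Matrix.zero_apply]
      refine Eq.trans ?_ (h α s s.2)
      rw [Fin.sum_univ_eq_sum_range
        (fun j => a (x α + j) * if (s : ℕ) ≤ j then g (j - s) else 0) (r + q)]
      have hsub : (Finset.range (r + 1)).image (fun j => (s : ℕ) + j) ⊆ Finset.range (r + q) := by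
        intro j hj
        simp only [Finset.mem_image, Finset.mem_range] at hj ⊢
        obtain ⟨j', hj', rfl⟩ := hj
        have := s.2
        omega
      rw [← Finset.sum_subset hsub, Finset.sum_image (by intro _ _ _ _ h; simpa using h)]
      · refine Finset.sum_congr rfl fun j _ => ?_
        rw [if_pos (by omega), Nat.add_sub_cancel_left, mul_comm, add_assoc]
      · intro j hj hj'
        by_cases hsj : (s : ℕ) ≤ j
        · rw [if_pos hsj, hg, mul_zero]
          by_contra hlt
          exact hj' (Finset.mem_image.2 ⟨j - s, by simp; omega, by omega⟩)
        · rw [if_neg hsj, mul_zero]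
    · simp [Matrix.toBlocks₂₁]
    · simp only [hW, hY, Matrix.mul_apply, Matrix.of_apply, Sum.elim_inr,
        Matrix.fromBlocks_apply₂₂, Matrix.transpose_apply]
      rw [Finset.sum_eq_single (⟨i + b, by omega⟩ : Fin (r + q))]
      · simp
      · intro j _ hj
        rw [if_neg, zero_mul]
        intro h'; exact hj (Fin.ext (by simpa using h'))
      · simp
  -- One enumeration must serve both factors here; Y is then evaluated in another order, which
  -- changes only a sign.
  have hdet : (W * Y).det = (W.submatrix id (skipEquiv r i q hi)).det *
      (Y.submatrix (skipEquiv r i q hi) id).det := by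
    rw [← Matrix.det_mul, Matrix.submatrix_mul_equiv]; simp
  have h1 := congrArg norm hdet
  rw [norm_mul, norm_det_submatrix_equiv Y (skipEquiv r i q hi) finSumFinEquiv, hYτ, hWσ, hWY,
    Matrix.det_fromBlocks_zero₁₂, Matrix.det_fromBlocks_zero₂₁, Matrix.det_fromBlocks_zero₂₁,
    Matrix.det_transpose, hU] at h1
  simpa [toeplitz, norm_mul, norm_pow, mul_comm] using h1

/-- A permutation which is nowhere decreasing is the identity. -/
theorem perm_eq_one_of_le {q : ℕ} (σ : Equiv.Perm (Fin q)) (h : ∀ b, b ≤ σ b) : σ = 1 := by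
  have h1 : ∑ b : Fin q, (b : ℕ) = ∑ b : Fin q, (σ b : ℕ) :=
    (Equiv.sum_comp σ (fun b : Fin q => (b : ℕ))).symm
  rw [Finset.sum_eq_sum_iff_of_le (fun b _ => Fin.le_def.1 (h b))] at h1
  ext b
  simpa using (h1 b (Finset.mem_univ b)).symm

/-- Isolates the diagonal term, which is to dominate all the others. -/
theorem toeplitz_eq {F : Type*} [CommRing F] (g : ℕ → F) (i q : ℕ) :
    toeplitz g i q = g i ^ q + ∑ σ ∈ Finset.univ.erase (1 : Equiv.Perm (Fin q)),
      Equiv.Perm.sign σ • ∏ b : Fin q,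
        if ((σ b : Fin q) : ℕ) ≤ i + b then g (i + b - σ b) else 0 := by
  rw [toeplitz, Matrix.det_apply, ← Finset.add_sum_erase _ _ (Finset.mem_univ 1)]
  simp

/-- Every term but the diagonal one of a Toeplitz determinant has a factor beyond the diagonal. -/
theorem prod_toeplitz_le {F : Type*} [NormedField F] (g : ℕ → F) (i q : ℕ) (c S T : ℝ)
    (hc : 0 < c) (hS : ∀ j, ‖g j‖ * c ^ j ≤ S) (hT : ∀ j, i < j → ‖g j‖ * c ^ j ≤ T)
    (hT0 : 0 ≤ T) (σ : Equiv.Perm (Fin q)) (hσ : σ ≠ 1) :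
    ‖Equiv.Perm.sign σ • ∏ b : Fin q,
      if ((σ b : Fin q) : ℕ) ≤ i + b then g (i + b - σ b) else 0‖ * c ^ (i * q) ≤
        T * S ^ (q - 1) := by
  have hS0 : 0 ≤ S := (by positivity : (0 : ℝ) ≤ ‖g 0‖ * c ^ 0).trans (hS 0)
  rw [Units.smul_def, zsmul_eq_mul, norm_mul, norm_prod]
  have h1 : ‖((Equiv.Perm.sign σ : ℤ) : F)‖ = 1 := by
    rcases Int.units_eq_one_or (Equiv.Perm.sign σ) with h | h <;> simp [h]
  rw [h1, one_mul]
  by_cases hall : ∀ b : Fin q, ((σ b : Fin q) : ℕ) ≤ i + b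
  · have h2 : ∏ b : Fin q, c ^ (i + b - (σ b : ℕ)) = c ^ (i * q) := by
      rw [Finset.prod_pow_eq_pow_sum]
      congr 1
      have : ∑ b : Fin q, (i + b - (σ b : ℕ)) + ∑ b : Fin q, (σ b : ℕ) =
          ∑ b : Fin q, (i + (b : ℕ)) := by
        rw [← Finset.sum_add_distrib]
        exact Finset.sum_congr rfl fun b _ => Nat.sub_add_cancel (hall b)
      rw [Equiv.sum_comp σ (fun b : Fin q => (b : ℕ)), Finset.sum_add_distrib] at this
      simp at this
      linarith
    -- For such b the entry has index i + b - σ b > i, so it is bounded by T; the remaining q - 1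
    -- entries are bounded by S.
    obtain ⟨b, hb⟩ : ∃ b, σ b < b := by
      by_contra hcon
      push Not at hcon
      exact hσ (perm_eq_one_of_le σ hcon)
    rw [← h2, ← Finset.prod_mul_distrib, ← Finset.mul_prod_erase _ _ (Finset.mem_univ b)]
    have hb' : (σ b : ℕ) < b := hb
    refine mul_le_mul ?_ ?_ (Finset.prod_nonneg fun _ _ => by positivity) hT0
    · rw [if_pos (hall b)]
      exact hT _ (by omega)
    · calc _ ≤ ∏ _b ∈ Finset.univ.erase b, S := by
            refine Finset.prod_le_prod (fun _ _ => by positivity) fun b' _ => ?_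
            rw [if_pos (hall b')]
            exact hS _
        _ = S ^ (q - 1) := by simp
  · push Not at hall
    obtain ⟨b, hb⟩ := hall
    rw [Finset.prod_eq_zero (Finset.mem_univ b) (by rw [if_neg (by omega), norm_zero]), zero_mul]
    positivity

end Determinants

/-! ### Gauss norms -/

section GaussNorm

variable {F : Type*} [NormedField F]

/-- The maximum of `‖p_i‖ c ^ i` over the coefficients of `P`. -/
noncomputable def gaussN (c : ℝ) (P : F[X]) : ℝ :=
  P.gaussNorm (NormedField.toAbsoluteValue F) c

theorem le_gaussN {c : ℝ} (hc : 0 ≤ c) (P : F[X]) (i : ℕ) : ‖P.coeff i‖ * c ^ i ≤ gaussN c P :=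
  P.le_gaussNorm (NormedField.toAbsoluteValue F) hc i

theorem exists_gaussN_eq (c : ℝ) (P : F[X]) : ∃ i, gaussN c P = ‖P.coeff i‖ * c ^ i :=
  P.exists_eq_gaussNorm (NormedField.toAbsoluteValue F) c

theorem gaussN_le {c B : ℝ} (P : F[X]) (h : ∀ i, ‖P.coeff i‖ * c ^ i ≤ B) : gaussN c P ≤ B := by
  obtain ⟨i, hi⟩ := exists_gaussN_eq c P
  exact hi ▸ h i

theorem gaussN_nonneg {c : ℝ} (hc : 0 ≤ c) (P : F[X]) : 0 ≤ gaussN c P :=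
  Polynomial.gaussNorm_nonneg _ _ hc

theorem gaussN_pos {c : ℝ} (hc : 0 < c) {P : F[X]} (hP : P ≠ 0) : 0 < gaussN c P := by
  have h : 0 < ‖P.leadingCoeff‖ := norm_pos_iff.2 (leadingCoeff_ne_zero.2 hP)
  exact (by positivity : (0 : ℝ) < ‖P.coeff P.natDegree‖ * c ^ P.natDegree).trans_le
    (le_gaussN hc.le P _)

theorem norm_coeff_le_gaussN (P : F[X]) (i : ℕ) : ‖P.coeff i‖ ≤ gaussN 1 P := by
  simpa using le_gaussN zero_le_one P i

theorem gaussN_mono {c c' : ℝ} (hc : 0 ≤ c) (hcc : c ≤ c') (P : F[X]) :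
    gaussN c P ≤ gaussN c' P :=
  gaussN_le P fun i => (by gcongr : ‖P.coeff i‖ * c ^ i ≤ ‖P.coeff i‖ * c' ^ i).trans
    (le_gaussN (hc.trans hcc) P i)

theorem gaussN_C_mul (c : ℝ) (hc : 0 ≤ c) (x : F) (P : F[X]) :
    gaussN c (C x * P) = ‖x‖ * gaussN c P := by
  apply le_antisymm
  · refine gaussN_le _ fun i => ?_
    rw [coeff_C_mul, norm_mul, mul_assoc]
    exact mul_le_mul_of_nonneg_left (le_gaussN hc P i) (norm_nonneg _)
  · obtain ⟨i, hi⟩ := exists_gaussN_eq c P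
    rw [hi, ← mul_assoc, ← norm_mul, ← coeff_C_mul]
    exact le_gaussN hc _ i

theorem gaussN_mul_of_ultrametric [IsUltrametricDist F] {c : ℝ} (hc : 0 < c) (P Q : F[X]) :
    gaussN c (P * Q) = gaussN c P * gaussN c Q :=
  gaussNorm_mul (fun x y => by
    exact IsUltrametricDist.norm_add_le_max x y) hc P Q

theorem gaussN_map {E : Type*} [NormedField E] (φ : F →+* E) (hφ : ∀ x, ‖φ x‖ = ‖x‖) (c : ℝ)
    (hc : 0 ≤ c) (P : F[X]) : gaussN c (P.map φ) = gaussN c P := by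
  apply le_antisymm
  · exact gaussN_le _ fun i => by rw [coeff_map, hφ]; exact le_gaussN hc P i
  · refine gaussN_le _ fun i => ?_
    rw [← hφ, ← coeff_map]; exact le_gaussN hc _ i

/-- Rescaling the variable reduces any radius to 1, where the Mahler measure is available. -/
theorem gaussN_comp_C_mul_X (P : F[X]) (x : F) :
    gaussN 1 (P.comp (C x * X)) = gaussN ‖x‖ P := by
  have h : ∀ i, ‖(P.comp (C x * X)).coeff i‖ * 1 ^ i = ‖P.coeff i‖ * ‖x‖ ^ i := fun i => by
    rw [comp_C_mul_X_coeff, norm_mul, norm_pow, one_pow, mul_one]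
  apply le_antisymm
  · exact gaussN_le _ fun i => (h i).trans_le (le_gaussN (norm_nonneg _) P i)
  · exact gaussN_le _ fun i => (h i).symm.trans_le (le_gaussN zero_le_one _ i)

theorem mahlerMeasure_le_gaussN (P : ℂ[X]) (n : ℕ) (hn : P.natDegree ≤ n) :
    P.mahlerMeasure ≤ (n + 1) * gaussN 1 P := by
  refine (mahlerMeasure_le_sum_norm_coeff P).trans ?_
  rw [Polynomial.sum_over_range _ (fun _ => norm_zero)]
  calc ∑ i ∈ Finset.range (P.natDegree + 1), ‖P.coeff i‖
      ≤ ∑ i ∈ Finset.range (P.natDegree + 1), gaussN 1 P :=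
        Finset.sum_le_sum fun i _ => norm_coeff_le_gaussN P i
    _ = (P.natDegree + 1) * gaussN 1 P := by simp
    _ ≤ (n + 1) * gaussN 1 P := by
        have := gaussN_nonneg zero_le_one P
        gcongr

theorem gaussN_le_mahlerMeasure (P : ℂ[X]) (n : ℕ) (hn : P.natDegree ≤ n) :
    gaussN 1 P ≤ 2 ^ n * P.mahlerMeasure := by
  refine gaussN_le _ fun i => ?_
  rw [one_pow, mul_one]
  refine (norm_coeff_le_choose_mul_mahlerMeasure i P).trans ?_
  refine mul_le_mul_of_nonneg_right ?_ (mahlerMeasure_nonneg P)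
  calc ((P.natDegree.choose i : ℕ) : ℝ) ≤ ((2 ^ P.natDegree : ℕ) : ℝ) :=
        Nat.cast_le.2 (Nat.choose_le_two_pow _ _)
    _ ≤ 2 ^ n := by push_cast; exact pow_le_pow_right₀ (by norm_num) hn

/-- Gauss norms over `ℂ` are multiplicative up to a constant. -/
theorem gaussN_mul_complex (n : ℕ) {c : ℝ} (hc : 0 < c) (P Q : ℂ[X]) (hn : (P * Q).natDegree ≤ n)
    (hPQ : P * Q ≠ 0) :
    gaussN c P * gaussN c Q ≤ (2 ^ n) ^ 2 * (n + 1) ^ 2 * gaussN c (P * Q) ∧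
      gaussN c (P * Q) ≤ (2 ^ n) ^ 2 * (n + 1) ^ 2 * (gaussN c P * gaussN c Q) := by
  have hc' : ‖(c : ℂ)‖ = c := by simp [abs_of_pos hc]
  have hdeg : ∀ R : ℂ[X], (R.comp (C (c : ℂ) * X)).natDegree ≤ R.natDegree := fun R => by
    rw [natDegree_comp]
    exact (Nat.mul_le_mul_left _ (natDegree_mul_le.trans (by simp))).trans (mul_one _).le
  have hnm := natDegree_mul (left_ne_zero_of_mul hPQ) (right_ne_zero_of_mul hPQ)
  have hP : (P.comp (C (c : ℂ) * X)).natDegree ≤ n := (hdeg P).trans (by omega)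
  have hQ : (Q.comp (C (c : ℂ) * X)).natDegree ≤ n := (hdeg Q).trans (by omega)
  have hPQn : ((P * Q).comp (C (c : ℂ) * X)).natDegree ≤ n := (hdeg _).trans hn
  rw [← hc', ← gaussN_comp_C_mul_X, ← gaussN_comp_C_mul_X, ← gaussN_comp_C_mul_X]
  -- The Mahler measure is exactly multiplicative, and comparable with the Gauss norm in bounded
  -- degree.
  have hm : ((P * Q).comp (C (c : ℂ) * X)).mahlerMeasure =
      (P.comp (C (c : ℂ) * X)).mahlerMeasure * (Q.comp (C (c : ℂ) * X)).mahlerMeasure := by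
    rw [mul_comp, mahlerMeasure_mul]
  generalize P.comp (C (c : ℂ) * X) = P' at *
  generalize Q.comp (C (c : ℂ) * X) = Q' at *
  generalize (P * Q).comp (C (c : ℂ) * X) = R' at *
  have hP0 := gaussN_nonneg zero_le_one P'
  have hQ0 := gaussN_nonneg zero_le_one Q'
  have hR0 := gaussN_nonneg zero_le_one R'
  have hn1 : (1 : ℝ) ≤ (n : ℝ) + 1 := by linarith [n.cast_nonneg (α := ℝ)]
  have h2 : (1 : ℝ) ≤ 2 ^ n := one_le_pow₀ (by norm_num)
  constructor
  · calc gaussN 1 P' * gaussN 1 Q' ≤ (2 ^ n * P'.mahlerMeasure) * (2 ^ n * Q'.mahlerMeasure) := by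
          gcongr
          · have := mahlerMeasure_nonneg P'; positivity
          · exact gaussN_le_mahlerMeasure _ _ hP
          · exact gaussN_le_mahlerMeasure _ _ hQ
      _ = (2 ^ n) ^ 2 * R'.mahlerMeasure := by rw [hm]; ring
      _ ≤ (2 ^ n) ^ 2 * ((n + 1) * gaussN 1 R') := by
          gcongr; exact mahlerMeasure_le_gaussN _ _ hPQn
      _ ≤ (2 ^ n) ^ 2 * ((n + 1) ^ 2 * gaussN 1 R') := by
          gcongr; nlinarith
      _ = _ := by ring
  · calc gaussN 1 R' ≤ 2 ^ n * R'.mahlerMeasure := gaussN_le_mahlerMeasure _ _ hPQn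
      _ = 2 ^ n * (P'.mahlerMeasure * Q'.mahlerMeasure) := by rw [hm]
      _ ≤ 2 ^ n * (((n + 1) * gaussN 1 P') * ((n + 1) * gaussN 1 Q')) := by
          gcongr
          · exact mahlerMeasure_nonneg Q'
          · exact mahlerMeasure_le_gaussN _ _ hP
          · exact mahlerMeasure_le_gaussN _ _ hQ
      _ ≤ (2 ^ n) ^ 2 * (((n + 1) * gaussN 1 P') * ((n + 1) * gaussN 1 Q')) := by
          gcongr; nlinarith
      _ = _ := by ring

/-! ### Dominant coefficients. -/

/-- The thresholds used to single out a dominant coefficient. -/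
noncomputable def threshold (n : ℕ) : ℕ → ℝ
  | 0 => 1
  | j + 1 => threshold n j ^ n / (2 * n.factorial)

theorem threshold_pos (n j : ℕ) : 0 < threshold n j := by
  induction j with
  | zero => simp [threshold]
  | succ j ih => rw [threshold]; positivity

theorem threshold_le_one (n j : ℕ) : threshold n j ≤ 1 := by
  induction j with
  | zero => simp [threshold]
  | succ j ih =>
    rw [threshold]
    have h1 : threshold n j ^ n ≤ 1 := pow_le_one₀ (threshold_pos n j).le ih
    have h2 : (1 : ℝ) ≤ n.factorial := by exact_mod_cast n.factorial_pos
    rw [div_le_one (by positivity)]; linarith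

theorem threshold_succ_le (n : ℕ) (hn : 1 ≤ n) (j : ℕ) : threshold n (j + 1) ≤ threshold n j := by
  rw [threshold]
  have h1 : threshold n j ^ n ≤ threshold n j ^ 1 :=
    pow_le_pow_of_le_one (threshold_pos n j).le (threshold_le_one n j) hn
  have h2 : (1 : ℝ) ≤ n.factorial := by exact_mod_cast n.factorial_pos
  have h3 := threshold_pos n j
  rw [div_le_iff₀ (by positivity)]
  nlinarith

theorem threshold_antitone (n : ℕ) (hn : 1 ≤ n) : Antitone (threshold n) :=
  antitone_nat_of_succ_le (threshold_succ_le n hn)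

/-- Every polynomial has a coefficient which is large and such that the Toeplitz determinants
with that diagonal entry are large. -/
theorem exists_dominant_coeff (n : ℕ) (hn : 1 ≤ n) {c : ℝ} (hc : 0 < c) (P : F[X]) (hP : P ≠ 0)
    (hdeg : P.natDegree ≤ n) :
    ∃ i ≤ P.natDegree, threshold n (n + 1) * gaussN c P ≤ ‖P.coeff i‖ * c ^ i ∧
      ∀ q ≤ n, threshold n (n + 1) * gaussN c P ^ q ≤ ‖toeplitz P.coeff i q‖ * c ^ (i * q) := by
  classical
  set S := gaussN c P with hS
  have hS0 : 0 < S := gaussN_pos hc hP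
  obtain ⟨i₀, hi₀⟩ := exists_gaussN_eq c P
  have hsupp : ∀ j, threshold n j * S ≤ ‖P.coeff j‖ * c ^ j → j ≤ P.natDegree := by
    intro j hj
    by_contra hlt
    rw [coeff_eq_zero_of_natDegree_lt (by omega)] at hj
    have := mul_pos (threshold_pos n j) hS0
    simp at hj; linarith
  set A := (Finset.range (n + 1)).filter fun j => threshold n j * S ≤ ‖P.coeff j‖ * c ^ j with hA
  have hmem : ∀ j, j ∈ A ↔ threshold n j * S ≤ ‖P.coeff j‖ * c ^ j := by
    intro j
    simp only [hA, Finset.mem_filter, Finset.mem_range, and_iff_right_iff_imp]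
    intro h; have := hsupp j h; omega
  have hAne : A.Nonempty := ⟨i₀, by
    rw [hmem, ← hi₀]; exact mul_le_of_le_one_left hS0.le (threshold_le_one n i₀)⟩
  -- The last index to pass its own threshold. As thresholds decrease, all later coefficients are
  -- below `threshold n (i + 1)` times S. This is `threshold n i ^ n / (2 * n!)` times S, so the at
  -- most n! nondiagonal terms add up to at most half of the lower bound for the diagonal one.
  set i := A.max' hAne with hi
  have hiA := (hmem i).1 (A.max'_mem hAne)
  have hin : i ≤ n := (hsupp i hiA).trans hdeg
  have hgt : ∀ j, i < j → ‖P.coeff j‖ * c ^ j ≤ threshold n (i + 1) * S := by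
    intro j hj
    have h1 : j ∉ A := fun h => absurd (A.le_max' j h) (by omega)
    rw [hmem] at h1
    push Not at h1
    exact h1.le.trans (by gcongr; exact threshold_antitone n hn hj)
  refine ⟨i, hsupp i hiA, ?_, fun q hq => ?_⟩
  · refine le_trans ?_ hiA
    gcongr
    exact threshold_antitone n hn (by omega)
  · set η := threshold n i with hη
    have hη0 : 0 < η := threshold_pos n i
    have hη1 : η ≤ 1 := threshold_le_one n i
    have herr : ‖∑ σ ∈ Finset.univ.erase (1 : Equiv.Perm (Fin q)),
        Equiv.Perm.sign σ • ∏ b : Fin q,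
          if ((σ b : Fin q) : ℕ) ≤ i + b then P.coeff (i + b - σ b) else 0‖ * c ^ (i * q) ≤
        η ^ n / 2 * S ^ q := by
      rcases Nat.eq_zero_or_pos q with rfl | hq0
      · have : Finset.univ.erase (1 : Equiv.Perm (Fin 0)) = ∅ := by
          ext σ; simp [Subsingleton.elim σ 1]
        rw [this]; simp; positivity
      refine (mul_le_mul_of_nonneg_right (norm_sum_le _ _) (by positivity)).trans ?_
      rw [Finset.sum_mul]
      refine (Finset.sum_le_sum fun σ hσ => prod_toeplitz_le P.coeff i q c S
        (threshold n (i + 1) * S) hc (fun j => le_gaussN hc.le P j) hgt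
        (mul_pos (threshold_pos _ _) hS0).le σ (Finset.ne_of_mem_erase hσ)).trans ?_
      rw [Finset.sum_const, nsmul_eq_mul, mul_assoc (threshold n (i + 1)), mul_pow_sub_one hq0.ne',
        ← mul_assoc]
      refine mul_le_mul_of_nonneg_right ?_ (by positivity)
      have hcard : ((Finset.univ.erase (1 : Equiv.Perm (Fin q))).card : ℝ) ≤ n.factorial := by
        have h1 : (Finset.univ.erase (1 : Equiv.Perm (Fin q))).card ≤ q.factorial :=
          (Finset.card_erase_le).trans (by simp [Fintype.card_perm])
        exact_mod_cast h1.trans (Nat.factorial_le hq)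
      calc _ ≤ (n.factorial : ℝ) * threshold n (i + 1) :=
            mul_le_mul_of_nonneg_right hcard (threshold_pos _ _).le
        _ = η ^ n / 2 := by
            rw [threshold, ← hη]
            have : (n.factorial : ℝ) ≠ 0 := by exact_mod_cast n.factorial_ne_zero
            field_simp
    have hmain : η ^ n * S ^ q ≤ ‖P.coeff i ^ q‖ * c ^ (i * q) := by
      rw [norm_pow, pow_mul, ← mul_pow]
      calc η ^ n * S ^ q ≤ η ^ q * S ^ q := by
            gcongr ?_ * _
            exact pow_le_pow_of_le_one hη0.le hη1 hq
        _ = (η * S) ^ q := (mul_pow _ _ _).symm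
        _ ≤ _ := by gcongr
    have hth : threshold n (n + 1) ≤ η ^ n / 2 := by
      refine (threshold_antitone n hn (by omega : i + 1 ≤ n + 1)).trans ?_
      rw [threshold]
      have h2 : (1 : ℝ) ≤ n.factorial := by exact_mod_cast n.factorial_pos
      gcongr
      linarith
    rw [toeplitz_eq]
    have htri := norm_sub_le_norm_add (P.coeff i ^ q)
      (∑ σ ∈ Finset.univ.erase (1 : Equiv.Perm (Fin q)),
        Equiv.Perm.sign σ • ∏ b : Fin q,
          if ((σ b : Fin q) : ℕ) ≤ i + b then P.coeff (i + b - σ b) else 0)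
    have hcp : 0 < c ^ (i * q) := by positivity
    have := mul_le_mul_of_nonneg_right htri hcp.le
    have hSq : 0 < S ^ q := by positivity
    nlinarith [mul_le_mul_of_nonneg_right hth hSq.le]

/-- The ultrametric version of `exists_dominant_coeff`, without constants. -/
theorem exists_dominant_coeff_of_ultrametric [IsUltrametricDist F] (P : F[X]) (hP : P ≠ 0) :
    ∃ i ≤ P.natDegree, ‖P.coeff i‖ = gaussN 1 P ∧
      ∀ q, gaussN 1 P ^ q ≤ ‖toeplitz P.coeff i q‖ := by
  classical
  set S := gaussN 1 P with hS
  have hS0 : 0 < S := gaussN_pos one_pos hP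
  obtain ⟨i₀, hi₀⟩ := exists_gaussN_eq 1 P
  rw [one_pow, mul_one] at hi₀
  have hsupp : ∀ j, ‖P.coeff j‖ = S → j ≤ P.natDegree := by
    intro j hj
    by_contra hlt
    rw [coeff_eq_zero_of_natDegree_lt (by omega), norm_zero] at hj
    exact hS0.ne hj
  set A := (Finset.range (P.natDegree + 1)).filter fun j => ‖P.coeff j‖ = S with hA
  have hmem : ∀ j, j ∈ A ↔ ‖P.coeff j‖ = S := by
    intro j
    simp only [hA, Finset.mem_filter, Finset.mem_range, and_iff_right_iff_imp]
    intro h; have := hsupp j h; omega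
  have hAne : A.Nonempty := ⟨i₀, (hmem _).2 hi₀.symm⟩
  -- The last index where the maximum is attained: every nondiagonal term is then strictly smaller
  -- than the diagonal one.
  set i := A.max' hAne with hi
  have hiA := (hmem i).1 (A.max'_mem hAne)
  have hgt : ∀ j, i < j → ‖P.coeff j‖ < S := fun j hj =>
    lt_of_le_of_ne (norm_coeff_le_gaussN P j) fun h =>
      absurd (A.le_max' j ((hmem j).2 h)) (by omega)
  refine ⟨i, hsupp i hiA, hiA, fun q => ?_⟩
  obtain ⟨T, hT0, hTS, hT⟩ : ∃ T, 0 ≤ T ∧ T < S ∧ ∀ j, i < j → ‖P.coeff j‖ ≤ T := by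
    rcases (Finset.Ioc i P.natDegree).eq_empty_or_nonempty with he | hne
    · refine ⟨0, le_rfl, hS0, fun j hj => ?_⟩
      have : P.natDegree < j := by
        by_contra hlt
        have : j ∈ Finset.Ioc i P.natDegree := Finset.mem_Ioc.2 ⟨hj, by omega⟩
        rw [he] at this; simp at this
      rw [coeff_eq_zero_of_natDegree_lt this, norm_zero]
    · obtain ⟨m, hm, hmax⟩ := Finset.exists_max_image _ (fun j => ‖P.coeff j‖) hne
      refine ⟨‖P.coeff m‖, norm_nonneg _, hgt m (Finset.mem_Ioc.1 hm).1, fun j hj => ?_⟩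
      by_cases hjn : j ≤ P.natDegree
      · exact hmax j (Finset.mem_Ioc.2 ⟨hj, hjn⟩)
      · rw [coeff_eq_zero_of_natDegree_lt (by omega), norm_zero]; exact norm_nonneg _
  have hlt : ‖∑ σ ∈ Finset.univ.erase (1 : Equiv.Perm (Fin q)),
        Equiv.Perm.sign σ • ∏ b : Fin q,
          if ((σ b : Fin q) : ℕ) ≤ i + b then P.coeff (i + b - σ b) else 0‖ < S ^ q := by
    rcases Nat.eq_zero_or_pos q with rfl | hq0
    · have : Finset.univ.erase (1 : Equiv.Perm (Fin 0)) = ∅ := by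
        ext σ; simp [Subsingleton.elim σ 1]
      rw [this]; simp
    · calc _ ≤ T * S ^ (q - 1) := by
            refine norm_sum_le_of_ultrametric _ _ (by positivity) fun σ hσ => ?_
            simpa using prod_toeplitz_le P.coeff i q 1 S T one_pos (fun j => le_gaussN zero_le_one P j)
              (fun j hj => by simpa using hT j hj) hT0 σ (Finset.ne_of_mem_erase hσ)
        _ < S * S ^ (q - 1) := by gcongr
        _ = S ^ q := mul_pow_sub_one hq0.ne' S
  rw [toeplitz_eq]
  have hnorm : ‖P.coeff i ^ q‖ = S ^ q := by rw [norm_pow, hiA]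
  rw [add_comm, IsUltrametricDist.norm_add_eq_max_of_norm_ne_norm (by rw [hnorm]; exact hlt.ne), hnorm]
  exact le_max_right _ _

end GaussNorm

/-! ### Resultants of polynomials whose Newton polygons are steep -/

theorem two_mul_sum_tsub (N M : ℕ) (h : N ≤ M) :
    2 * ∑ c ∈ Finset.range M, (N - c) = N * (N + 1) := by
  induction M, h using Nat.le_induction with
  | base =>
    induction N with
    | zero => simp
    | succ N ih =>
      rw [Finset.sum_range_succ', mul_add]
      simp only [Nat.add_sub_add_right, ih]
      simp; ring
  | succ M h ih => rw [Finset.sum_range_succ, Nat.sub_eq_zero_of_le h, add_zero, ih]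

/-- Truncated subtraction is essential. The sum of (N + N' - c)⁺ over all c is (N+N')(N+N'+1)/2 for
every σ. Replacing N by a in the first block, and N' by b in the second, loses at most N(N+1)/2 and
N'(N'+1)/2. The difference is N N'. -/
theorem mul_le_sum_perm_nat (m n N N' : ℕ) (hN : N ≤ m) (hN' : N' ≤ n)
    (σ : Equiv.Perm (Fin (m + n))) :
    N * N' ≤ ∑ a : Fin m, (N' + a - σ (Fin.castAdd n a)) +
      ∑ b : Fin n, (N + b - σ (Fin.natAdd m b)) := by
  have h1 : ∑ c ∈ Finset.range (m + n), (N + N' - c) =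
      ∑ a : Fin m, (N + N' - σ (Fin.castAdd n a)) + ∑ b : Fin n, (N + N' - σ (Fin.natAdd m b)) := by
    rw [Finset.sum_range, ← Fin.sum_univ_add (fun j => N + N' - (σ j : ℕ))]
    exact (Equiv.sum_comp σ (fun c : Fin (m + n) => N + N' - (c : ℕ))).symm
  have h2 : ∑ a : Fin m, (N + N' - σ (Fin.castAdd n a)) ≤
      ∑ a : Fin m, (N' + a - σ (Fin.castAdd n a)) + ∑ a ∈ Finset.range m, (N - a) := by
    rw [Finset.sum_range, ← Finset.sum_add_distrib]
    exact Finset.sum_le_sum fun a _ => by omega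
  have h3 : ∑ b : Fin n, (N + N' - σ (Fin.natAdd m b)) ≤
      ∑ b : Fin n, (N + b - σ (Fin.natAdd m b)) + ∑ b ∈ Finset.range n, (N' - b) := by
    rw [Finset.sum_range, ← Finset.sum_add_distrib]
    exact Finset.sum_le_sum fun a _ => by omega
  have e1 := two_mul_sum_tsub (N + N') (m + n) (by omega)
  have e2 := two_mul_sum_tsub N m hN
  have e3 := two_mul_sum_tsub N' n hN'
  nlinarith

theorem max_sub_interpolate (N : ℕ) (f : ℝ) (h0 : 0 ≤ f) (h1 : f ≤ 1) (j : ℤ) :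
    max ((N : ℝ) + f - j) 0 = (1 - f) * max ((N : ℝ) - j) 0 + f * max (((N + 1 : ℕ) : ℝ) - j) 0 := by
  rcases lt_or_ge (N : ℤ) j with h | h
  · have h' : (N : ℝ) + 1 ≤ j := by exact_mod_cast h
    rw [max_eq_right (by linarith), max_eq_right (by linarith), max_eq_right (by push_cast; linarith)]
    simp
  · have h' : (j : ℝ) ≤ N := by exact_mod_cast h
    rw [max_eq_left (by linarith), max_eq_left (by linarith), max_eq_left (by push_cast; linarith)]
    push_cast; ring

theorem exists_interpolate {m : ℕ} {z : ℝ} (h0 : 0 ≤ z) (hz : z ≤ m) :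
    ∃ (N : ℕ) (f : ℝ), 0 ≤ f ∧ f ≤ 1 ∧ z = N + f ∧ N ≤ m ∧ (N + 1 ≤ m ∨ f = 0) := by
  refine ⟨⌊z⌋₊, z - ⌊z⌋₊, by linarith [Nat.floor_le h0], by linarith [Nat.lt_floor_add_one z],
    by ring, Nat.floor_le_of_le hz, ?_⟩
  rcases hz.lt_or_eq with h | h
  · exact Or.inl ((Nat.floor_lt h0).2 h)
  · right; simp [h]

/-- On each unit square with integral corners both sides are recovered from their corner values by
bilinear interpolation, which reduces the claim to integers. -/
theorem mul_le_sum_perm (m n : ℕ) (z z' : ℝ) (h0 : 0 ≤ z) (hz : z ≤ m) (h0' : 0 ≤ z')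
    (hz' : z' ≤ n) (σ : Equiv.Perm (Fin (m + n))) :
    z * z' ≤ ∑ a : Fin m, max (z' - (((σ (Fin.castAdd n a) : ℕ) - (a : ℕ) : ℤ) : ℝ)) 0 +
      ∑ b : Fin n, max (z - (((σ (Fin.natAdd m b) : ℕ) - (b : ℕ) : ℤ) : ℝ)) 0 := by
  set A : ℕ → ℝ := fun N' =>
    ∑ a : Fin m, max ((N' : ℝ) - (((σ (Fin.castAdd n a) : ℕ) - (a : ℕ) : ℤ) : ℝ)) 0 with hA
  set B : ℕ → ℝ := fun N =>
    ∑ b : Fin n, max ((N : ℝ) - (((σ (Fin.natAdd m b) : ℕ) - (b : ℕ) : ℤ) : ℝ)) 0 with hB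
  have hint : ∀ N N' : ℕ, N ≤ m → N' ≤ n → ((N : ℝ) * N') ≤ A N' + B N := by
    intro N N' hN hN'
    have hc : ∀ x y s : ℕ, ((x + y - s : ℕ) : ℝ) = max ((x : ℝ) - (((s : ℤ) - (y : ℤ) : ℤ) : ℝ)) 0 := by
      intro x y s
      rcases le_total s (x + y) with h | h
      · have h' : (s : ℝ) ≤ x + y := by exact_mod_cast h
        rw [Nat.cast_sub h, max_eq_left (by push_cast; linarith)]; push_cast; ring
      · have h' : (x + y : ℝ) ≤ s := by exact_mod_cast h
        rw [Nat.sub_eq_zero_of_le h, max_eq_right (by push_cast; linarith)]; simp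
    have := mul_le_sum_perm_nat m n N N' hN hN' σ
    simp only [hA, hB, ← hc]
    exact_mod_cast this
  obtain ⟨N, f, hf0, hf1, rfl, hN, hNf⟩ := exists_interpolate h0 hz
  obtain ⟨N', f', hf0', hf1', rfl, hN', hNf'⟩ := exists_interpolate h0' hz'
  simp only [max_sub_interpolate _ _ hf0 hf1, max_sub_interpolate _ _ hf0' hf1',
    Finset.sum_add_distrib, ← Finset.mul_sum]
  change _ ≤ (1 - f') * A N' + f' * A (N' + 1) + ((1 - f) * B N + f * B (N + 1))
  have i00 := hint N N' hN hN'
  -- If z = m, the corner N + 1 is out of range, but its weight f is then 0.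
  have i10 : f * ((N + 1 : ℕ) * N' : ℝ) ≤ f * (A N' + B (N + 1)) := by
    rcases hNf with h | h
    · exact mul_le_mul_of_nonneg_left (hint (N + 1) N' h hN') hf0
    · simp [h]
  have i01 : f' * (N * (N' + 1 : ℕ) : ℝ) ≤ f' * (A (N' + 1) + B N) := by
    rcases hNf' with h | h
    · exact mul_le_mul_of_nonneg_left (hint N (N' + 1) hN h) hf0'
    · simp [h]
  have i11 : f * f' * ((N + 1 : ℕ) * (N' + 1 : ℕ) : ℝ) ≤
      f * f' * (A (N' + 1) + B (N + 1)) := by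
    rcases hNf with h | h
    · rcases hNf' with h' | h'
      · exact mul_le_mul_of_nonneg_left (hint (N + 1) (N' + 1) h h') (by positivity)
      · simp [h']
    · simp [h]
  have j00 := mul_le_mul_of_nonneg_left i00 (mul_nonneg (sub_nonneg.2 hf1) (sub_nonneg.2 hf1'))
  have j10 := mul_le_mul_of_nonneg_left i10 (sub_nonneg.2 hf1')
  have j01 := mul_le_mul_of_nonneg_left i01 (sub_nonneg.2 hf1)
  push_cast at j00 j10 j01 i11
  linarith

/-- Heuristically, f and g have z and z' roots in the disk of radius ρ, and each pair of such roots
contributes a factor ρ to the resultant. In the Sylvester determinant this gain is present in every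
term, by `mul_le_sum_perm`. -/
theorem norm_resultant_le {F : Type*} [NormedField F] (f g : F[X]) (m n : ℕ)
    (S S' ρ z z' : ℝ) (hρ : 0 < ρ) (hρ1 : ρ ≤ 1) (hS : 0 ≤ S) (hS' : 0 ≤ S')
    (h0 : 0 ≤ z) (hz : z ≤ m) (h0' : 0 ≤ z') (hz' : z' ≤ n)
    (hf : ∀ j : ℕ, ‖f.coeff j‖ ≤ S * ρ ^ max (z - j) 0)
    (hg : ∀ j : ℕ, ‖g.coeff j‖ ≤ S' * ρ ^ max (z' - j) 0) :
    ‖resultant f g m n‖ ≤ (m + n).factorial * (S ^ n * S' ^ m * ρ ^ (z * z')) := by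
  rw [resultant, Matrix.det_apply]
  refine (norm_sum_le _ _).trans ?_
  have : ∀ σ ∈ (Finset.univ : Finset (Equiv.Perm (Fin (m + n)))),
      ‖Equiv.Perm.sign σ • ∏ i, sylvester f g m n (σ i) i‖ ≤ S ^ n * S' ^ m * ρ ^ (z * z') := by
    intro σ _
    rw [Units.smul_def, zsmul_eq_mul, norm_mul, norm_prod, Fin.prod_univ_add]
    have hs : ‖((Equiv.Perm.sign σ : ℤ) : F)‖ = 1 := by
      rcases Int.units_eq_one_or (Equiv.Perm.sign σ) with h | h <;> simp [h]
    rw [hs, one_mul]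
    have e1 : ∀ a : Fin m, ‖sylvester f g m n (σ (Fin.castAdd n a)) (Fin.castAdd n a)‖ ≤
        S' * ρ ^ max (z' - (((σ (Fin.castAdd n a) : ℕ) - (a : ℕ) : ℤ) : ℝ)) 0 := by
      intro a
      rw [sylvester, Matrix.of_apply, Fin.addCases_left]
      split_ifs with h
      · refine (hg _).trans_eq ?_
        rw [Nat.cast_sub h.1]; push_cast; rfl
      · rw [norm_zero]; positivity
    have e2 : ∀ b : Fin n, ‖sylvester f g m n (σ (Fin.natAdd m b)) (Fin.natAdd m b)‖ ≤
        S * ρ ^ max (z - (((σ (Fin.natAdd m b) : ℕ) - (b : ℕ) : ℤ) : ℝ)) 0 := by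
      intro a
      rw [sylvester, Matrix.of_apply, Fin.addCases_right]
      split_ifs with h
      · refine (hf _).trans_eq ?_
        rw [Nat.cast_sub h.1]; push_cast; rfl
      · rw [norm_zero]; positivity
    refine (mul_le_mul (Finset.prod_le_prod (fun _ _ => norm_nonneg _) fun a _ => e1 a)
      (Finset.prod_le_prod (fun _ _ => norm_nonneg _) fun a _ => e2 a)
      (Finset.prod_nonneg fun _ _ => norm_nonneg _)
      (Finset.prod_nonneg fun _ _ => by positivity)).trans ?_
    rw [Finset.prod_mul_distrib, Finset.prod_mul_distrib, ← Real.rpow_sum_of_pos hρ,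
      ← Real.rpow_sum_of_pos hρ]
    simp only [Finset.prod_const, Finset.card_univ, Fintype.card_fin]
    rw [mul_mul_mul_comm, ← Real.rpow_add hρ, mul_comm (S' ^ m)]
    refine mul_le_mul_of_nonneg_left ?_ (by positivity)
    exact Real.rpow_le_rpow_of_exponent_ge hρ hρ1 (mul_le_sum_perm m n z z' h0 hz h0' hz' σ)
  refine (Finset.sum_le_sum this).trans_eq ?_
  simp [Fintype.card_perm]

theorem norm_resultant_le_of_ultrametric {F : Type*} [NormedField F] [IsUltrametricDist F]
    (f g : F[X]) (m n : ℕ) :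
    ‖resultant f g m n‖ ≤ gaussN 1 f ^ n * gaussN 1 g ^ m := by
  have hf := gaussN_nonneg zero_le_one f
  have hg := gaussN_nonneg zero_le_one g
  have := norm_det_le_of_col_le_of_ultrametric (sylvester f g m n)
    (Fin.addCases (fun _ => gaussN 1 g) (fun _ => gaussN 1 f))
    (fun j => by induction j using Fin.addCases <;> simp [hf, hg])
    (fun i j => by
      induction j using Fin.addCases with
      | left j =>
        rw [sylvester, Matrix.of_apply, Fin.addCases_left, Fin.addCases_left]
        split_ifs
        · exact norm_coeff_le_gaussN _ _
        · rw [norm_zero]; exact hg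
      | right j =>
        rw [sylvester, Matrix.of_apply, Fin.addCases_right, Fin.addCases_right]
        split_ifs
        · exact norm_coeff_le_gaussN _ _
        · rw [norm_zero]; exact hf)
  rw [Fin.prod_univ_add] at this
  simpa [resultant, mul_comm] using this

universe u

/-! ### Sums over the places -/

namespace Place

variable {K : Type u} [Field K] [NumberField K]

instance instIsUltrametricDist (v : IsDedekindDomain.HeightOneSpectrum (𝓞 K)) :
    IsUltrametricDist (ultra v).Completion :=
  inferInstanceAs (IsUltrametricDist (v.adicCompletion K))

theorem exists_isometry_complex (v : NumberField.InfinitePlace K) :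
    ∃ φ : (arch v).Completion →+* ℂ, ∀ x, ‖φ x‖ = ‖x‖ :=
  ⟨NumberField.InfinitePlace.Completion.extensionEmbedding v, fun x =>
    (AddMonoidHomClass.isometry_iff_norm _).1
      (NumberField.InfinitePlace.Completion.isometry_extensionEmbedding v) x⟩

theorem norm_algebraMap_arch (v : NumberField.InfinitePlace K) (x : K) :
    ‖algebraMap K (arch v).Completion x‖ = v x :=
  NumberField.InfinitePlace.Completion.norm_coe v ((WithAbs.equiv v.1).symm x)

theorem norm_algebraMap_ultra (v : IsDedekindDomain.HeightOneSpectrum (𝓞 K)) (x : K) :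
    ‖algebraMap K (ultra v).Completion x‖ =
      NumberField.FinitePlace.equivHeightOneSpectrum.symm v x := by
  rw [NumberField.FinitePlace.equivHeightOneSpectrum_symm_apply]
  rfl

/-- The exponent of the normalized absolute value in the product formula. -/
noncomputable def weight : Place K → ℝ
  | arch v => v.mult
  | ultra _ => 1

theorem weight_pos (v : Place K) : 0 < v.weight := by
  cases v with
  | arch v => simpa [weight] using v.mult_pos
  | ultra v => simp [weight]

theorem weight_le_two (v : Place K) : v.weight ≤ 2 := by
  cases v with
  | arch v =>
    have : v.mult ≤ 2 := by rw [NumberField.InfinitePlace.mult]; split_ifs <;> norm_num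
    simp only [weight]; exact_mod_cast this
  | ultra v => simp [weight]

theorem normExponent_eq (v : Place K) : v.normExponent = v.weight / Module.finrank ℚ K := by
  cases v <;> simp [normExponent, weight]

/-- The constant `C` at the Archimedean places, and `0` elsewhere. -/
def archConst (C : ℝ) : Place K → ℝ
  | arch _ => C
  | ultra _ => 0

theorem finsum_eq (f : Place K → ℝ) (hf : f.support.Finite) :
    ∑ᶠ v, f v = ∑ v : NumberField.InfinitePlace K, f (arch v) + ∑ᶠ v, f (ultra v) := by
  have hu : (Set.univ : Set (Place K)) = Set.range arch ∪ Set.range ultra := by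
    ext v; cases v <;> simp
  have hd : Disjoint (Set.range (arch (K := K))) (Set.range ultra) := by
    rw [Set.disjoint_left]
    rintro _ ⟨v, rfl⟩ ⟨v', h⟩
    cases h
  rw [← finsum_mem_univ, hu, finsum_mem_union' hd (hf.subset Set.inter_subset_right)
    (hf.subset Set.inter_subset_right), finsum_mem_range (fun _ _ h => arch.inj h),
    finsum_mem_range (fun _ _ h => ultra.inj h), finsum_eq_sum_of_fintype]

theorem support_archConst (C : ℝ) : (archConst (K := K) C).support.Finite := by
  refine (Set.finite_range (arch (K := K))).subset ?_
  intro v hv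
  cases v with
  | arch v => exact ⟨v, rfl⟩
  | ultra v => exact absurd rfl hv

theorem finsum_archConst (C : ℝ) : ∑ᶠ v : Place K, v.archConst C =
    Fintype.card (NumberField.InfinitePlace K) * C := by
  rw [finsum_eq _ (support_archConst C)]
  simp [archConst]

theorem finsum_le_finsum {f g : Place K → ℝ} (hf : f.support.Finite) (hg : g.support.Finite)
    (h : ∀ v, f v ≤ g v) : ∑ᶠ v, f v ≤ ∑ᶠ v, g v := by
  have hs := hf.union hg
  rw [finsum_eq_sum_of_support_subset f (s := hs.toFinset) (by simp),
    finsum_eq_sum_of_support_subset g (s := hs.toFinset) (by simp)]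
  exact Finset.sum_le_sum fun v _ => h v

/-- The form in which sums over places are estimated: a bounded error at the Archimedean places,
none at the ultrametric ones, and a separate bound at w. -/
theorem finsum_le_of_le (w : Place K) (f : Place K → ℝ) (hf : f.support.Finite) {C B : ℝ}
    (hC : 0 ≤ C) (hfv : ∀ v ≠ w, f v ≤ v.archConst C) (hfw : f w ≤ B) :
    ∑ᶠ v, f v ≤ Fintype.card (NumberField.InfinitePlace K) * C + B := by
  classical
  set g : Place K → ℝ := fun v => v.archConst C + if v = w then B - w.archConst C else 0 with hg
  have hg2 : (fun v : Place K => if v = w then B - w.archConst C else 0).support.Finite :=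
    (Set.finite_singleton w).subset fun v hv => by
      by_contra h; exact hv (if_neg h)
  have hgs : g.support.Finite :=
    ((support_archConst C).union hg2).subset (Function.support_add _ _)
  have hle : ∀ v, f v ≤ g v := by
    intro v
    by_cases h : v = w
    · subst h; simpa [hg] using hfw
    · simpa [hg, h] using hfv v h
  have hw : 0 ≤ w.archConst C := by cases w <;> simp [archConst, hC]
  calc ∑ᶠ v, f v ≤ ∑ᶠ v, g v := finsum_le_finsum hf hgs hle
    _ = Fintype.card (NumberField.InfinitePlace K) * C + (B - w.archConst C) := by
        rw [hg, finsum_add_distrib (support_archConst C) hg2, finsum_archConst,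
          finsum_eq_single _ w (fun v hv => if_neg hv), if_pos rfl]
    _ ≤ _ := by linarith

theorem support_log_norm_algebraMap {x : K} (hx : x ≠ 0) :
    (fun v : Place K => v.weight * Real.log ‖algebraMap K v.Completion x‖).support.Finite := by
  have h := NumberField.FinitePlace.hasFiniteMulSupport hx
  refine ((Set.finite_range (arch (K := K))).union
    ((Set.Finite.image (fun v => ultra (NumberField.FinitePlace.equivHeightOneSpectrum v)) h))).subset
    fun v hv => ?_
  cases v with
  | arch v => exact Or.inl ⟨v, rfl⟩
  | ultra v =>
    right
    refine ⟨NumberField.FinitePlace.equivHeightOneSpectrum.symm v, ?_, by simp⟩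
    intro h1
    apply hv
    simp only [norm_algebraMap_ultra]
    rw [show NumberField.FinitePlace.equivHeightOneSpectrum.symm v x = 1 from h1]; simp

/-- The logarithmic product formula. -/
theorem finsum_log_norm_algebraMap {x : K} (hx : x ≠ 0) :
    ∑ᶠ v : Place K, v.weight * Real.log ‖algebraMap K v.Completion x‖ = 0 := by
  have h : (Function.mulSupport fun v : NumberField.FinitePlace K => v x).Finite :=
    NumberField.FinitePlace.hasFiniteMulSupport hx
  have hp := NumberField.prod_abs_eq_one hx
  rw [finsum_eq _ (support_log_norm_algebraMap hx)]
  simp only [norm_algebraMap_arch, norm_algebraMap_ultra, weight, one_mul]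
  rw [finsum_comp_equiv NumberField.FinitePlace.equivHeightOneSpectrum.symm
    (f := fun v => Real.log (v x))]
  have hs : (fun v : NumberField.FinitePlace K => Real.log (v x)).support ⊆ h.toFinset := by
    intro v hv
    simp only [Set.Finite.coe_toFinset]
    intro h1
    apply hv
    change Real.log (v x) = 0
    rw [show v x = 1 from h1]; simp
  rw [finsum_eq_sum_of_support_subset _ hs]
  rw [finprod_eq_prod_of_mulSupport_subset (s := h.toFinset) _ (by simp)] at hp
  have hpos : ∀ v : NumberField.InfinitePlace K, v x ≠ 0 := fun v => by simpa using hx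
  have hpos' : ∀ v : NumberField.FinitePlace K, v x ≠ 0 := fun v =>
    (NumberField.FinitePlace.pos_iff.2 hx).ne'
  have := congrArg Real.log hp
  rw [Real.log_mul (Finset.prod_ne_zero_iff.2 fun v _ => pow_ne_zero _ (hpos v))
    (Finset.prod_ne_zero_iff.2 fun v _ => hpos' v), Real.log_prod fun v _ => pow_ne_zero _ (hpos v),
    Real.log_prod fun v _ => hpos' v, Real.log_one] at this
  simpa [Real.log_pow] using this

/-- Gauss norms over completions are almost multiplicative. -/
theorem abs_log_gaussN_mul_le (v : Place K) (n : ℕ) {c : ℝ} (hc : 0 < c) (P Q : v.Completion[X])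
    (hP : P ≠ 0) (hQ : Q ≠ 0) (hn : (P * Q).natDegree ≤ n) :
    |v.weight * (Real.log (gaussN c (P * Q)) - Real.log (gaussN c P) - Real.log (gaussN c Q))| ≤
      v.archConst (2 * Real.log ((2 ^ n) ^ 2 * (n + 1) ^ 2)) := by
  have hP' := gaussN_pos hc hP
  have hQ' := gaussN_pos hc hQ
  have hPQ' := gaussN_pos hc (mul_ne_zero hP hQ)
  cases v with
  | ultra v =>
    rw [gaussN_mul_of_ultrametric hc, Real.log_mul hP'.ne' hQ'.ne']
    simp [archConst]
  | arch v =>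
    obtain ⟨φ, hφ⟩ := exists_isometry_complex v
    have hinj : Function.Injective φ := φ.injective
    have h := gaussN_mul_complex n hc (P.map φ) (Q.map φ)
      (by rw [← Polynomial.map_mul, natDegree_map]; exact hn)
      (by rw [← Polynomial.map_mul]; exact (Polynomial.map_ne_zero_iff hinj).2 (mul_ne_zero hP hQ))
    rw [← Polynomial.map_mul, gaussN_map φ hφ c hc.le, gaussN_map φ hφ c hc.le,
      gaussN_map φ hφ c hc.le] at h
    have hC : (0 : ℝ) < (2 ^ n) ^ 2 * (n + 1) ^ 2 := by positivity
    have h1 := Real.log_le_log (by positivity) h.1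
    have h2 := Real.log_le_log (by positivity) h.2
    rw [Real.log_mul hC.ne' (by positivity), Real.log_mul hP'.ne' hQ'.ne'] at h1 h2
    rw [abs_mul, abs_of_pos (weight_pos _)]
    refine mul_le_mul (weight_le_two _) ?_ (abs_nonneg _) zero_le_two
    rw [abs_le]; constructor <;> linarith

end Place

/-! ### Heights and local drops of polynomials -/

section Height

variable {K : Type u} [Field K] [NumberField K] (w : Place K) (ξ : w.Completion)

open Classical in
/-- The element `ξ` of `K_w`, and `0` in the other completions. -/
noncomputable def center (v : Place K) : v.Completion :=
  Function.update (fun v : Place K => (0 : v.Completion)) w ξ v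

/-- The polynomial `P` over `K_v`, expanded around `ξ` if `v = w` and around `0` otherwise. -/
noncomputable def locPoly (v : Place K) (P : K[X]) : v.Completion[X] :=
  taylor (center w ξ v) (P.map (algebraMap K v.Completion))

theorem locPoly_self (P : K[X]) :
    locPoly w ξ w P = taylor ξ (P.map (algebraMap K w.Completion)) := by
  simp [locPoly, center]

theorem locPoly_of_ne {v : Place K} (hv : v ≠ w) (P : K[X]) :
    locPoly w ξ v P = P.map (algebraMap K v.Completion) := by
  simp [locPoly, center, hv]

theorem locPoly_ne_zero (v : Place K) {P : K[X]} (hP : P ≠ 0) : locPoly w ξ v P ≠ 0 := by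
  rw [locPoly, Ne, taylor_eq_zero]
  exact Polynomial.map_ne_zero hP

theorem natDegree_locPoly (v : Place K) (P : K[X]) :
    (locPoly w ξ v P).natDegree = P.natDegree := by
  rw [locPoly, natDegree_taylor, natDegree_map]

theorem coeff_natDegree_locPoly (v : Place K) (P : K[X]) :
    (locPoly w ξ v P).coeff P.natDegree = algebraMap K v.Completion P.leadingCoeff := by
  have := leadingCoeff_map (algebraMap K v.Completion) (p := P)
  rw [← this, ← leadingCoeff_taylor (r := center w ξ v), leadingCoeff, natDegree_taylor, natDegree_map]
  rfl

theorem locPoly_mul (v : Place K) (P Q : K[X]) :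
    locPoly w ξ v (P * Q) = locPoly w ξ v P * locPoly w ξ v Q := by
  rw [locPoly, Polynomial.map_mul, taylor_mul]; rfl

theorem locPoly_C_mul (v : Place K) (a : K) (P : K[X]) :
    locPoly w ξ v (C a * P) = C (algebraMap K v.Completion a) * locPoly w ξ v P := by
  rw [locPoly_mul, locPoly, map_C, taylor_C]

/-- The weighted logarithm of the Gauss norm at `v`. -/
noncomputable def logNorm (v : Place K) (P : K[X]) : ℝ :=
  v.weight * Real.log (gaussN 1 (locPoly w ξ v P))

/-- Away from w, the Gauss norm is 1 as soon as every nonzero coefficient has absolute value 1. -/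
theorem support_logNorm {P : K[X]} (hP : P ≠ 0) :
    (fun v => logNorm w ξ v P).support.Finite := by
  have hfin : ({w} ∪ ⋃ i ∈ P.support, (fun v : Place K =>
      v.weight * Real.log ‖algebraMap K v.Completion (P.coeff i)‖).support).Finite :=
    (Set.finite_singleton w).union (Set.Finite.biUnion (P.support.finite_toSet) fun i hi =>
      Place.support_log_norm_algebraMap (mem_support_iff.1 hi))
  refine hfin.subset fun v hv => ?_
  by_contra hnot
  simp only [Set.mem_union, Set.mem_singleton_iff, Set.mem_iUnion, not_or, not_exists] at hnot
  obtain ⟨hvw, hnot⟩ := hnot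
  have h1 : ∀ i ∈ P.support, ‖algebraMap K v.Completion (P.coeff i)‖ = 1 := by
    intro i hi
    have := hnot i hi
    simp only [Function.mem_support, not_not] at this
    refine Real.eq_one_of_pos_of_log_eq_zero ?_
      ((mul_eq_zero.1 this).resolve_left v.weight_pos.ne')
    rw [norm_pos_iff, Ne, map_eq_zero]
    exact mem_support_iff.1 hi
  apply hv
  have : gaussN 1 (locPoly w ξ v P) = 1 := by
    rw [locPoly_of_ne w ξ hvw]
    apply le_antisymm
    · refine gaussN_le _ fun i => ?_
      rw [one_pow, mul_one, coeff_map]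
      by_cases hi : i ∈ P.support
      · exact (h1 i hi).le
      · rw [notMem_support_iff.1 hi, map_zero, norm_zero]; exact zero_le_one
    · have := norm_coeff_le_gaussN (P.map (algebraMap K v.Completion)) P.natDegree
      rwa [coeff_map, h1 P.natDegree (natDegree_mem_support_of_nonzero hP)] at this
  simp [logNorm, this]

/-- A logarithmic height. -/
noncomputable def height (P : K[X]) : ℝ :=
  ∑ᶠ v, logNorm w ξ v P

/-- Translation preserves the leading coefficient, which the Gauss norm dominates at every place;
the product formula concludes. -/
theorem height_nonneg {P : K[X]} (hP : P ≠ 0) : 0 ≤ height w ξ P := by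
  have h0 : P.leadingCoeff ≠ 0 := leadingCoeff_ne_zero.2 hP
  rw [← Place.finsum_log_norm_algebraMap h0]
  refine Place.finsum_le_finsum (Place.support_log_norm_algebraMap h0) (support_logNorm w ξ hP)
    fun v => mul_le_mul_of_nonneg_left ?_ v.weight_pos.le
  refine Real.log_le_log (by rw [norm_pos_iff, Ne, map_eq_zero]; exact h0) ?_
  rw [← coeff_natDegree_locPoly w ξ]
  exact norm_coeff_le_gaussN _ _

/-- The constant of the Gauss lemma. -/
noncomputable def gaussConst (n : ℕ) : ℝ :=
  2 * Real.log ((2 ^ n) ^ 2 * (n + 1) ^ 2)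

theorem gaussConst_nonneg (n : ℕ) : 0 ≤ gaussConst n := by
  have h2 : (1 : ℝ) ≤ 2 ^ n := one_le_pow₀ (by norm_num)
  have h3 : (1 : ℝ) ≤ (n : ℝ) + 1 := by linarith [n.cast_nonneg (α := ℝ)]
  exact mul_nonneg zero_le_two (Real.log_nonneg
    (one_le_mul_of_one_le_of_one_le (one_le_pow₀ h2) (one_le_pow₀ h3)))

theorem Place.archConst_le {C : ℝ} (hC : 0 ≤ C) (v : Place K) : v.archConst C ≤ C := by
  cases v
  · exact le_rfl
  · exact hC

theorem height_mul_ge (n : ℕ) {P Q : K[X]} (hP : P ≠ 0) (hQ : Q ≠ 0)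
    (hn : (P * Q).natDegree ≤ n) :
    height w ξ P + height w ξ Q ≤ height w ξ (P * Q) +
      (Fintype.card (NumberField.InfinitePlace K) + 1) * gaussConst n := by
  have sP := support_logNorm w ξ hP
  have sQ := support_logNorm w ξ hQ
  have sPQ := support_logNorm w ξ (mul_ne_zero hP hQ)
  have key : ∀ v, logNorm w ξ v P + logNorm w ξ v Q - logNorm w ξ v (P * Q) ≤
      v.archConst (gaussConst n) := by
    intro v
    have := (abs_le.1 (Place.abs_log_gaussN_mul_le v n one_pos _ _ (locPoly_ne_zero w ξ v hP)
      (locPoly_ne_zero w ξ v hQ) (by rw [← locPoly_mul, natDegree_locPoly]; exact hn))).1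
    rw [← locPoly_mul] at this
    simp only [logNorm, gaussConst]
    linarith
  have s1 : (fun v => logNorm w ξ v P + logNorm w ξ v Q).support.Finite :=
    (sP.union sQ).subset (Function.support_add _ _)
  have := Place.finsum_le_of_le w (fun v => logNorm w ξ v P + logNorm w ξ v Q -
      logNorm w ξ v (P * Q)) ((s1.union sPQ).subset (Function.support_sub _ _))
      (gaussConst_nonneg n) (fun v _ => key v)
      ((key w).trans (Place.archConst_le (gaussConst_nonneg n) w))
  rw [finsum_sub_distrib s1 sPQ, finsum_add_distrib sP sQ] at this
  simp only [height]
  linarith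

/-! ### The drop at w, and resultants. -/

/-- How much the Gauss norm at `w` decreases when one passes from the unit disk to the disk of
radius `ρ` around `ξ`. -/
noncomputable def drop (ρ : ℝ) (P : K[X]) : ℝ :=
  w.weight * (Real.log (gaussN 1 (locPoly w ξ w P)) - Real.log (gaussN ρ (locPoly w ξ w P)))

theorem drop_mul_le (n : ℕ) {ρ : ℝ} (hρ : 0 < ρ) {P Q : K[X]} (hP : P ≠ 0) (hQ : Q ≠ 0)
    (hn : (P * Q).natDegree ≤ n) :
    drop w ξ ρ (P * Q) ≤ drop w ξ ρ P + drop w ξ ρ Q + 2 * gaussConst n := by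
  have h1 := (abs_le.1 (Place.abs_log_gaussN_mul_le w n one_pos _ _ (locPoly_ne_zero w ξ w hP)
      (locPoly_ne_zero w ξ w hQ) (by rw [← locPoly_mul, natDegree_locPoly]; exact hn))).2
  have h2 := (abs_le.1 (Place.abs_log_gaussN_mul_le w n hρ _ _ (locPoly_ne_zero w ξ w hP)
      (locPoly_ne_zero w ξ w hQ) (by rw [← locPoly_mul, natDegree_locPoly]; exact hn))).1
  have h3 := Place.archConst_le (gaussConst_nonneg n) w
  rw [← locPoly_mul] at h1 h2
  simp only [drop]
  simp only [gaussConst] at *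
  linarith

theorem drop_C_mul {ρ : ℝ} (hρ : 0 < ρ) {a : K} (ha : a ≠ 0) {P : K[X]} (hP : P ≠ 0) :
    drop w ξ ρ (C a * P) = drop w ξ ρ P := by
  have h0 : ‖algebraMap K w.Completion a‖ ≠ 0 := by
    rw [norm_ne_zero_iff, Ne, map_eq_zero]; exact ha
  have hP' := locPoly_ne_zero w ξ w hP
  rw [drop, locPoly_C_mul, gaussN_C_mul _ zero_le_one, gaussN_C_mul _ hρ.le,
    Real.log_mul h0 (gaussN_pos one_pos hP').ne', Real.log_mul h0 (gaussN_pos hρ hP').ne', drop]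
  ring

theorem drop_anti {ρ ρ' : ℝ} (hρ : 0 < ρ) (h : ρ ≤ ρ') {P : K[X]} (hP : P ≠ 0) :
    drop w ξ ρ' P ≤ drop w ξ ρ P := by
  refine mul_le_mul_of_nonneg_left ?_ w.weight_pos.le
  have := Real.log_le_log (gaussN_pos hρ (locPoly_ne_zero w ξ w hP))
    (gaussN_mono hρ.le h (locPoly w ξ w P))
  linarith

theorem drop_nonneg {ρ : ℝ} (hρ : 0 < ρ) (h : ρ ≤ 1) {P : K[X]} (hP : P ≠ 0) :
    0 ≤ drop w ξ ρ P := by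
  have := drop_anti w ξ hρ h hP
  simpa [drop] using this

/-- A nonzero coefficient of index `j` bounds the drop. -/
theorem drop_le_of_coeff (V : ℝ) {P : K[X]} (j : ℕ) (hj : (locPoly w ξ w P).coeff j ≠ 0) :
    drop w ξ (Real.exp (-V / w.weight)) P ≤ j * V + w.weight *
      (Real.log (gaussN 1 (locPoly w ξ w P)) - Real.log ‖(locPoly w ξ w P).coeff j‖) := by
  have hw := w.weight_pos
  have h1 := Real.log_le_log (mul_pos (norm_pos_iff.2 hj) (by positivity))
    (le_gaussN (Real.exp_pos (-V / w.weight)).le (locPoly w ξ w P) j)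
  rw [Real.log_mul (norm_ne_zero_iff.2 hj) (by positivity), Real.log_pow, Real.log_exp] at h1
  have h2 := mul_le_mul_of_nonneg_left h1 hw.le
  have h3 : w.weight * (j * (-V / w.weight)) = - (j * V) := by field_simp
  rw [drop]
  linarith

theorem drop_le_natDegree_mul {V : ℝ} (hV : 0 ≤ V) {P : K[X]} (hP : P ≠ 0) :
    drop w ξ (Real.exp (-V / w.weight)) P ≤ P.natDegree * V := by
  have hP' := locPoly_ne_zero w ξ w hP
  obtain ⟨j, hj⟩ := exists_gaussN_eq 1 (locPoly w ξ w P)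
  rw [one_pow, mul_one] at hj
  have hpos := gaussN_pos one_pos hP'
  have hj0 : (locPoly w ξ w P).coeff j ≠ 0 := by
    rw [← norm_pos_iff, ← hj]; exact hpos
  have h := drop_le_of_coeff w ξ V j hj0
  rw [← hj, sub_self, mul_zero, add_zero] at h
  refine h.trans (mul_le_mul_of_nonneg_right ?_ hV)
  have := le_natDegree_of_ne_zero hj0
  rw [natDegree_locPoly] at this
  exact_mod_cast this

/-- With ρ = exp(-V/`w.weight`) and M the drop, ρ^(M/V) is the quotient of the Gauss norms at radii
ρ and 1. This yields the shape of coefficients required by `norm_resultant_le`, with z = M/V. -/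
theorem norm_coeff_locPoly_le {V : ℝ} (hV : 0 < V) {P : K[X]} (hP : P ≠ 0) (j : ℕ) :
    ‖(locPoly w ξ w P).coeff j‖ ≤ gaussN 1 (locPoly w ξ w P) *
      Real.exp (-V / w.weight) ^ max (drop w ξ (Real.exp (-V / w.weight)) P / V - j) 0 := by
  have hw := w.weight_pos
  have hpos := gaussN_pos one_pos (locPoly_ne_zero w ξ w hP)
  by_cases hj : (locPoly w ξ w P).coeff j = 0
  · rw [hj, norm_zero]; positivity
  rcases le_total (drop w ξ (Real.exp (-V / w.weight)) P / V - j) 0 with h | h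
  · rw [max_eq_right h, Real.rpow_zero, mul_one]
    exact norm_coeff_le_gaussN _ _
  · rw [max_eq_left h, ← Real.exp_mul, ← Real.exp_log hpos, ← Real.exp_add,
      ← Real.log_le_iff_le_exp (norm_pos_iff.2 hj)]
    have h1 := drop_le_of_coeff w ξ V j hj
    set M := drop w ξ (Real.exp (-V / w.weight)) P
    have h2 : w.weight * (-V / w.weight * (M / V - j)) = j * V - M := by field_simp; ring
    have : w.weight * Real.log ‖(locPoly w ξ w P).coeff j‖ ≤
        w.weight * (Real.log (gaussN 1 (locPoly w ξ w P)) + -V / w.weight * (M / V - j)) := by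
      linarith
    exact le_of_mul_le_mul_left this hw

/-- The resultant is invariant under translation, so each place may use its own center. -/
theorem algebraMap_resultant (v : Place K) (P Q : K[X]) :
    algebraMap K v.Completion (resultant P Q) =
      resultant (locPoly w ξ v P) (locPoly w ξ v Q) P.natDegree Q.natDegree := by
  have := resultant_taylor (P.map (algebraMap K v.Completion)) (Q.map (algebraMap K v.Completion))
    (center w ξ v)
  rw [natDegree_taylor, natDegree_taylor, natDegree_map, natDegree_map] at this
  rw [← resultant_map_map, ← this]
  rfl

/-- Coprime polynomials cannot both have large drops. -/
theorem drop_mul_drop_le (k : ℕ) {V : ℝ} (hV : 0 < V) {P Q : K[X]} (hP : P ≠ 0) (hQ : Q ≠ 0)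
    (hPk : P.natDegree ≤ k) (hQk : Q.natDegree ≤ k) (hPQ : IsCoprime P Q) :
    drop w ξ (Real.exp (-V / w.weight)) P * drop w ξ (Real.exp (-V / w.weight)) Q / V ≤
      Q.natDegree * height w ξ P + P.natDegree * height w ξ Q +
        (Fintype.card (NumberField.InfinitePlace K) + 1) *
          (2 * Real.log ((k + k).factorial)) := by
  have hR := resultant_ne_zero P Q hPQ
  set m := P.natDegree
  set n := Q.natDegree
  set R := resultant P Q
  set M := drop w ξ (Real.exp (-V / w.weight)) P
  set M' := drop w ξ (Real.exp (-V / w.weight)) Q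
  set C := 2 * Real.log ((k + k).factorial)
  have hfac : (1 : ℝ) ≤ (m + n).factorial := by exact_mod_cast (m + n).factorial_pos
  have hfac' : ((m + n).factorial : ℝ) ≤ (k + k).factorial := by
    exact_mod_cast Nat.factorial_le (by omega)
  have hC0 : 0 ≤ C := mul_nonneg zero_le_two (Real.log_nonneg (hfac.trans hfac'))
  have hCv : ∀ v : Place K, v.weight * Real.log ((m + n).factorial) ≤ C := fun v =>
    mul_le_mul v.weight_le_two (Real.log_le_log (by linarith) hfac') (Real.log_nonneg hfac)
      zero_le_two
  have sR := Place.support_log_norm_algebraMap hR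
  have sP := support_logNorm w ξ hP
  have sQ := support_logNorm w ξ hQ
  have hRv : ∀ v : Place K, 0 < ‖algebraMap K v.Completion R‖ := fun v => by
    rw [norm_pos_iff, Ne, map_eq_zero]; exact hR
  have hSv : ∀ v : Place K, 0 < gaussN 1 (locPoly w ξ v P) := fun v =>
    gaussN_pos one_pos (locPoly_ne_zero w ξ v hP)
  have hTv : ∀ v : Place K, 0 < gaussN 1 (locPoly w ξ v Q) := fun v =>
    gaussN_pos one_pos (locPoly_ne_zero w ξ v hQ)
  have hlog : ∀ (v : Place K) (c x : ℝ), 0 < c → ‖algebraMap K v.Completion R‖ ≤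
      c * (gaussN 1 (locPoly w ξ v P) ^ n * gaussN 1 (locPoly w ξ v Q) ^ m * Real.exp x) →
      v.weight * Real.log ‖algebraMap K v.Completion R‖ - n * logNorm w ξ v P -
        m * logNorm w ξ v Q ≤ v.weight * Real.log c + v.weight * x := by
    intro v c x hc h
    have h1 := Real.log_le_log (hRv v) h
    have hS := hSv v
    have hT := hTv v
    rw [Real.log_mul hc.ne' (by positivity), Real.log_mul (by positivity) (by positivity),
      Real.log_mul (by positivity) (by positivity), Real.log_pow, Real.log_pow, Real.log_exp] at h1
    have h2 := mul_le_mul_of_nonneg_left h1 v.weight_pos.le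
    simp only [logNorm]
    linarith
  have hw := w.weight_pos
  have s1 : (fun v => n * logNorm w ξ v P).support.Finite :=
    sP.subset fun v hv h => hv (by simp only [h, mul_zero])
  have s2 : (fun v => m * logNorm w ξ v Q).support.Finite :=
    sQ.subset fun v hv h => hv (by simp only [h, mul_zero])
  have s3 := (sR.union s1).subset (Function.support_sub _ _)
  have hz : 0 ≤ M / V := div_nonneg (drop_nonneg w ξ (Real.exp_pos _)
    (Real.exp_le_one_iff.2 (by rw [neg_div]; exact neg_nonpos.2 (by positivity))) hP) hV.le
  have hz' : 0 ≤ M' / V := div_nonneg (drop_nonneg w ξ (Real.exp_pos _)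
    (Real.exp_le_one_iff.2 (by rw [neg_div]; exact neg_nonpos.2 (by positivity))) hQ) hV.le
  -- At w the resultant gains ρ^((M/V)(M'/V)), whose weighted logarithm is -M M'/V.
  have main := Place.finsum_le_of_le w (fun v => v.weight * Real.log ‖algebraMap K v.Completion R‖ -
      n * logNorm w ξ v P - m * logNorm w ξ v Q) ((s3.union s2).subset (Function.support_sub _ _))
      hC0 (B := C - M * M' / V) ?_ ?_
  · rw [finsum_sub_distrib s3 s2, finsum_sub_distrib sR s1,
      Place.finsum_log_norm_algebraMap hR, ← mul_finsum, ← mul_finsum] at main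
    simp only [height]
    linarith
  · intro v hv
    cases v with
    | ultra v =>
      have := norm_resultant_le_of_ultrametric (locPoly w ξ _ P) (locPoly w ξ (Place.ultra v) Q) m n
      rw [← algebraMap_resultant] at this
      simpa [Place.archConst] using hlog (Place.ultra v) 1 0 one_pos (by simpa using this)
    | arch v =>
      have := norm_resultant_le (locPoly w ξ _ P) (locPoly w ξ (Place.arch v) Q) m n
        (gaussN 1 (locPoly w ξ _ P)) (gaussN 1 (locPoly w ξ _ Q)) 1 0 0 one_pos le_rfl
        (hSv _).le (hTv _).le le_rfl (by positivity) le_rfl (by positivity)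
        (fun j => by simpa using norm_coeff_le_gaussN _ _)
        (fun j => by simpa using norm_coeff_le_gaussN _ _)
      rw [← algebraMap_resultant] at this
      have h2 := hlog (Place.arch v) ((m + n).factorial) 0 (by linarith) (by simpa using this)
      rw [mul_zero, add_zero] at h2
      exact h2.trans (hCv _)
  · have := norm_resultant_le (locPoly w ξ w P) (locPoly w ξ w Q) m n
        (gaussN 1 (locPoly w ξ _ P)) (gaussN 1 (locPoly w ξ _ Q)) (Real.exp (-V / w.weight))
        (M / V) (M' / V) (Real.exp_pos _)
        (Real.exp_le_one_iff.2 (by rw [neg_div]; exact neg_nonpos.2 (by positivity)))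
        (hSv _).le (hTv _).le hz
        (by rw [div_le_iff₀ hV]; exact drop_le_natDegree_mul w ξ hV.le hP) hz'
        (by rw [div_le_iff₀ hV]; exact drop_le_natDegree_mul w ξ hV.le hQ)
        (norm_coeff_locPoly_le w ξ hV hP) (norm_coeff_locPoly_le w ξ hV hQ)
    rw [← algebraMap_resultant, ← Real.exp_mul] at this
    have h2 := hlog w _ _ (by linarith) this
    have h3 : w.weight * (-V / w.weight * (M / V * (M' / V))) = - (M * M' / V) := by field_simp
    rw [h3] at h2
    linarith [hCv w]

end Height

/-- A subadditive function which is not too small at a polynomial is not too small at one of its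
irreducible factors. -/
theorem exists_irreducible_dvd {K : Type*} [Field K] (Φ : K[X] → ℝ) (k : ℕ) (B : ℝ)
    (hΦ : ∀ P Q : K[X], P ≠ 0 → Q ≠ 0 → (P * Q).natDegree ≤ k → Φ (P * Q) ≤ Φ P + Φ Q + B)
    (G : K[X]) (hG : 0 < G.natDegree) (hGk : G.natDegree ≤ k) (hB : -B ≤ Φ G) :
    ∃ p, Irreducible p ∧ p ∣ G ∧ -B ≤ Φ p := by
  induction hr : G.natDegree using Nat.strong_induction_on generalizing G with
  | _ r ih =>
    have hG0 : G ≠ 0 := by rintro rfl; simp at hG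
    have hGu : ¬ IsUnit G := fun h => by rw [natDegree_eq_zero_of_isUnit h] at hG; exact hG.false
    by_cases hirr : Irreducible G
    · exact ⟨G, hirr, dvd_rfl, hB⟩
    · rw [irreducible_iff] at hirr
      push Not at hirr
      obtain ⟨P, Q, hPQ, hPu, hQu⟩ := hirr hGu
      have hP0 : P ≠ 0 := by rintro rfl; simp at hPQ; exact hG0 hPQ
      have hQ0 : Q ≠ 0 := by rintro rfl; simp at hPQ; exact hG0 hPQ
      have hdeg := natDegree_mul hP0 hQ0
      rw [← hPQ] at hdeg
      have hPd : 0 < P.natDegree := Nat.pos_of_ne_zero fun h =>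
        hPu ((isUnit_iff_degree_eq_zero).2 (by rw [degree_eq_natDegree hP0, h]; rfl))
      have hQd : 0 < Q.natDegree := Nat.pos_of_ne_zero fun h =>
        hQu ((isUnit_iff_degree_eq_zero).2 (by rw [degree_eq_natDegree hQ0, h]; rfl))
      have hsub := hΦ P Q hP0 hQ0 (by rw [← hPQ]; exact hGk)
      rw [← hPQ] at hsub
      -- No loss accumulates: if Φ P < -B, then Φ Q ≥ Φ G - Φ P - B > -B.
      by_cases h : -B ≤ Φ P
      · obtain ⟨p, h1, h2, h3⟩ := ih P.natDegree (by omega) P hPd (by omega) h rfl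
        exact ⟨p, h1, h2.trans ⟨Q, hPQ⟩, h3⟩
      · obtain ⟨p, h1, h2, h3⟩ := ih Q.natDegree (by omega) Q hQd (by omega)
          (by push Not at h; linarith) rfl
        exact ⟨p, h1, h2.trans ⟨P, by rw [hPQ, mul_comm]⟩, h3⟩

/-! ### Moment functionals -/

section Moment

variable {F : Type*} [Field F]

/-- The linear form on `F[X]` which maps `X ^ l` to `q l`. -/
noncomputable def moment (q : ℕ → F) : F[X] →ₗ[F] F :=
  Polynomial.lsum fun l => LinearMap.toSpanSingleton F F (q l)

theorem moment_eq_sum (q : ℕ → F) (P : F[X]) : moment q P = P.sum fun l c => c * q l := by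
  simp [moment, Polynomial.lsum_apply]

theorem moment_X_pow (q : ℕ → F) (l : ℕ) : moment q (X ^ l) = q l := by
  rw [moment_eq_sum, X_pow_eq_monomial, sum_monomial_index _ (fun l c => c * q l) (zero_mul _),
    one_mul]

theorem moment_eq_sum_range (q : ℕ → F) {P : F[X]} {N : ℕ} (hN : P.natDegree < N) :
    moment q P = ∑ l ∈ Finset.range N, P.coeff l * q l := by
  rw [moment_eq_sum, sum_over_range' _ (fun l => zero_mul (q l)) N hN]

theorem moment_map {E : Type*} [Field E] (φ : F →+* E) (q : ℕ → F) (P : F[X]) :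
    moment (fun l => φ (q l)) (P.map φ) = φ (moment q P) := by
  rw [moment_eq_sum_range _ (Nat.lt_succ_self _), moment_eq_sum_range q (N := P.natDegree.succ)
    (Nat.lt_succ_self _), natDegree_map, map_sum]
  simp

theorem moment_mul_eq_sum (q : ℕ → F) (R P : F[X]) (ξ : F) {N : ℕ} (hN : P.natDegree < N) :
    moment q (P * R) =
      ∑ j ∈ Finset.range N, (taylor ξ P).coeff j * moment q ((X - C ξ) ^ j * R) := by
  conv_lhs => rw [← sum_taylor_eq P ξ]
  rw [sum_over_range' _ (by simp) N (by rwa [natDegree_taylor]), Finset.sum_mul, map_sum]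
  refine Finset.sum_congr rfl fun j _ => ?_
  rw [mul_assoc, ← smul_eq_C_mul, map_smul, smul_eq_mul]

/-- The change of basis from the powers of X to those of X - ξ is triangular with unit diagonal. -/
theorem det_moment_mul_X_sub_C_pow (q : ℕ → F) (ξ : F) {r : ℕ} (R : Fin r → F[X]) :
    (Matrix.of fun α β : Fin r => moment q ((X - C ξ) ^ (β : ℕ) * R α)).det =
      (Matrix.of fun α β : Fin r => moment q (X ^ (β : ℕ) * R α)).det := by
  set U : Matrix (Fin r) (Fin r) F := Matrix.of fun c β => ((X - C ξ) ^ (β : ℕ)).coeff c with hU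
  have hdeg : ∀ β : ℕ, ((X - C ξ) ^ β).natDegree = β := fun β => by
    rw [natDegree_pow, natDegree_X_sub_C, mul_one]
  have hdet : U.det = 1 := by
    rw [Matrix.det_of_isUpperTriangular]
    · refine Finset.prod_eq_one fun β _ => ?_
      have := ((monic_X_sub_C ξ).pow (β : ℕ)).coeff_natDegree
      rw [hdeg] at this
      exact this
    · intro c β h
      exact coeff_eq_zero_of_natDegree_lt ((hdeg β).trans_lt h)
  have hmul : (Matrix.of fun α β : Fin r => moment q ((X - C ξ) ^ (β : ℕ) * R α)) =
      (Matrix.of fun α β : Fin r => moment q (X ^ (β : ℕ) * R α)) * U := by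
    ext α β
    rw [Matrix.mul_apply, Matrix.of_apply, moment_mul_eq_sum q _ _ 0 (N := r)
      (by rw [hdeg]; exact β.2), Finset.sum_range]
    refine Finset.sum_congr rfl fun c _ => ?_
    rw [taylor_zero, C_0, sub_zero, mul_comm]; rfl
  rw [hmul, Matrix.det_mul, hdet, mul_one]

/-- Hankel determinants of moments are invariant under translations. -/
theorem det_moment_X_sub_C_pow (q : ℕ → F) (ξ : F) (r : ℕ) :
    (Matrix.of fun α β : Fin r => moment q ((X - C ξ) ^ ((α : ℕ) + β))).det =
      (Matrix.of fun α β : Fin r => q ((α : ℕ) + β)).det := by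
  have h1 := det_moment_mul_X_sub_C_pow q ξ fun α : Fin r => (X - C ξ) ^ (α : ℕ)
  have h2 := det_moment_mul_X_sub_C_pow q ξ fun α : Fin r => X ^ (α : ℕ)
  have h3 : (Matrix.of fun α β : Fin r => moment q (X ^ (β : ℕ) * (X - C ξ) ^ (α : ℕ))) =
      (Matrix.of fun α β : Fin r => moment q ((X - C ξ) ^ (β : ℕ) * X ^ (α : ℕ))).transpose := by
    ext α β; simp [mul_comm]
  rw [h3, Matrix.det_transpose, h2] at h1
  simp only [← pow_add, moment_X_pow] at h1
  convert h1 using 3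
  · ext α β; rw [add_comm]
  · ext α β; rw [add_comm]

theorem moment_mul_eq_zero (q : ℕ → F) (G : F[X]) {m : ℕ}
    (h : ∀ l ≤ m, moment q (G * X ^ l) = 0) (R : F[X]) (hR : R.natDegree ≤ m) :
    moment q (G * R) = 0 := by
  rw [mul_comm, moment_mul_eq_sum q G R 0 (Nat.lt_succ_of_le hR)]
  refine Finset.sum_eq_zero fun j hj => ?_
  rw [C_0, sub_zero, mul_comm (X ^ j), h j (by simpa [Nat.lt_succ_iff] using hj), mul_zero]

/-- If all maximal minors vanish, there is a nonzero vector in the kernel. -/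
theorem exists_kernel_of_minors {ι : Type*} {p : ℕ} (M : ι → Fin p → F)
    (h : ∀ f : Fin p → ι, (Matrix.of fun α β => M (f α) β).det = 0) :
    ∃ v : Fin p → F, v ≠ 0 ∧ ∀ i, ∑ β, M i β * v β = 0 := by
  by_cases hs : Submodule.span F (Set.range M) = ⊤
  · exfalso
    obtain ⟨κ, a, ha, hsp, hli⟩ := exists_linearIndependent' F M
    let b := Module.Basis.mk hli (by rw [hsp, hs])
    have : Fintype κ := Module.Basis.fintypeIndexOfRankLtAleph0 b (by
      rw [rank_fin_fun]; exact Cardinal.natCast_lt_aleph0)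
    have hcard : Fintype.card κ = Fintype.card (Fin p) := by
      rw [← Module.finrank_eq_card_basis b]; simp
    let e := Fintype.equivOfCardEq hcard
    have hli' : LinearIndependent F fun α : Fin p => M (a (e.symm α)) :=
      hli.comp _ e.symm.injective
    have hu : IsUnit (Matrix.of fun α β => M (a (e.symm α)) β) :=
      Matrix.linearIndependent_rows_iff_isUnit.1 hli'
    rw [Matrix.isUnit_iff_isUnit_det] at hu
    exact hu.ne_zero (h _)
  · obtain ⟨φ, hφ, hle⟩ := Submodule.exists_le_ker_of_lt_top _ (lt_top_iff_ne_top.2 hs)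
    refine ⟨fun β => φ (Pi.single β 1), fun h0 => hφ ?_, fun i => ?_⟩
    · ext β
      simpa using congrFun h0 β
    · have : φ (M i) = 0 := hle (Submodule.subset_span ⟨i, rfl⟩)
      rw [← this]
      conv_rhs => rw [pi_eq_sum_univ' (M i), map_sum]
      refine Finset.sum_congr rfl fun β _ => ?_
      rw [map_smul, smul_eq_mul]

/-- The polynomial with coefficients `v`. -/
noncomputable def ofCoeffs {p : ℕ} (v : Fin p → F) : F[X] :=
  ∑ β : Fin p, C (v β) * X ^ (β : ℕ)

theorem coeff_ofCoeffs {p : ℕ} (v : Fin p → F) (β : Fin p) : (ofCoeffs v).coeff β = v β := by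
  simp [ofCoeffs, coeff_C_mul, coeff_X_pow, Fin.val_inj]

theorem ofCoeffs_ne_zero {p : ℕ} {v : Fin p → F} (hv : v ≠ 0) : ofCoeffs v ≠ 0 := by
  intro h
  apply hv
  ext β
  rw [← coeff_ofCoeffs v β, h]; simp

theorem natDegree_ofCoeffs_lt {p : ℕ} {v : Fin p → F} (hv : v ≠ 0) :
    (ofCoeffs v).natDegree < p := by
  rw [natDegree_lt_iff_degree_lt (ofCoeffs_ne_zero hv)]
  refine degree_sum_fin_lt v

theorem moment_ofCoeffs_mul (q : ℕ → F) {p : ℕ} (v : Fin p → F) (l : ℕ) :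
    moment q (ofCoeffs v * X ^ l) = ∑ β : Fin p, q (l + β) * v β := by
  rw [ofCoeffs, Finset.sum_mul, map_sum]
  refine Finset.sum_congr rfl fun β _ => ?_
  rw [mul_assoc, ← pow_add, ← smul_eq_C_mul, map_smul, moment_X_pow, smul_eq_mul, mul_comm,
    add_comm]

/-- A minimal recurrence satisfied by a sequence whose Hankel matrix is degenerate, and the
nonvanishing of the corresponding Hankel determinant. -/
theorem exists_recurrence (q : ℕ → F) (k m : ℕ)
    (hdet : ∀ f : Fin (k + 1) → ℕ, (∀ α, f α ≤ m) →
      (Matrix.of fun α β : Fin (k + 1) => q (f α + β)).det = 0) :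
    ∃ G : F[X], G ≠ 0 ∧ G.natDegree ≤ k ∧ (∀ l ≤ m, moment q (G * X ^ l) = 0) ∧
      (Matrix.of fun α β : Fin G.natDegree => q ((α : ℕ) + β)).det ≠ 0 := by
  classical
  have hex : ∃ r, ∃ G : F[X], G ≠ 0 ∧ G.natDegree = r ∧ ∀ l ≤ m, moment q (G * X ^ l) = 0 := by
    obtain ⟨v, hv, hv0⟩ := exists_kernel_of_minors
      (fun (l : Fin (m + 1)) (β : Fin (k + 1)) => q (l + β))
      (fun f => hdet (fun α => f α) fun α => Nat.lt_succ_iff.1 (f α).2)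
    exact ⟨_, ofCoeffs v, ofCoeffs_ne_zero hv, rfl, fun l hl => by
      rw [moment_ofCoeffs_mul]; exact hv0 ⟨l, Nat.lt_succ_of_le hl⟩⟩
  have hle : Nat.find hex ≤ k := by
    obtain ⟨v, hv, hv0⟩ := exists_kernel_of_minors
      (fun (l : Fin (m + 1)) (β : Fin (k + 1)) => q (l + β))
      (fun f => hdet (fun α => f α) fun α => Nat.lt_succ_iff.1 (f α).2)
    refine (Nat.find_min' hex ⟨ofCoeffs v, ofCoeffs_ne_zero hv, rfl, fun l hl => by
      rw [moment_ofCoeffs_mul]; exact hv0 ⟨l, Nat.lt_succ_of_le hl⟩⟩).trans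
      (Nat.lt_succ_iff.1 (natDegree_ofCoeffs_lt hv))
  obtain ⟨G, hG0, hGr, hG⟩ := Nat.find_spec hex
  -- A kernel vector would give a polynomial of degree < r orthogonal to X^l for l < r. Dividing X^l
  -- by G extends this orthogonality to all l ≤ m, against the minimality of r.
  refine ⟨G, hG0, hGr.trans_le hle, hG, fun h0 => ?_⟩
  set r := G.natDegree with hr
  obtain ⟨v, hv, hv0⟩ := Matrix.exists_mulVec_eq_zero_iff.2 h0
  have hrec : ∀ l < r, moment q (ofCoeffs v * X ^ l) = 0 := fun l hl => by
    rw [moment_ofCoeffs_mul]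
    exact congrFun hv0 ⟨l, hl⟩
  have hdegv := natDegree_ofCoeffs_lt hv
  refine Nat.find_min hex (m := (ofCoeffs v).natDegree) (by omega)
    ⟨ofCoeffs v, ofCoeffs_ne_zero hv, rfl, fun l hl => ?_⟩
  have hr0 : 0 < r := by omega
  rw [← EuclideanDomain.div_add_mod (X ^ l : F[X]) G, mul_add, map_add]
  have hmod : (X ^ l % G).natDegree < r := natDegree_mod_lt _ hr0.ne'
  have h1 : moment q (ofCoeffs v * (X ^ l % G)) = 0 :=
    moment_mul_eq_zero q _ (m := r - 1) (fun l hl => hrec l (by omega)) _ (by omega)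
  rw [h1, add_zero, mul_left_comm]
  by_cases hdiv : X ^ l / G = 0
  · rw [hdiv]; simp
  refine moment_mul_eq_zero q G hG _ ?_
  have h2 : (G * (X ^ l / G)).natDegree ≤ max l (r - 1) := by
    have : G * (X ^ l / G) = X ^ l - X ^ l % G :=
      eq_sub_of_add_eq (EuclideanDomain.div_add_mod (X ^ l : F[X]) G)
    rw [this]
    refine (natDegree_sub_le _ _).trans (max_le_max ?_ (by omega))
    exact natDegree_X_pow_le l
  rw [natDegree_mul hG0 hdiv] at h2
  refine natDegree_mul_le.trans ?_
  rcases le_total l (r - 1) with h | h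
  · rw [max_eq_right h] at h2; omega
  · rw [max_eq_left h] at h2; omega

/-! ### The sequence dual to a polynomial. -/

/-- The sequence attached to a polynomial of degree at most `n`. -/
noncomputable def dualSeq (n : ℕ) (Q : F[X]) (l : ℕ) : F :=
  (-1) ^ l * l.factorial * (n - l).factorial * Q.coeff (n - l)

theorem dualSeq_map {E : Type*} [Field E] (φ : F →+* E) (n : ℕ) (Q : F[X]) (l : ℕ) :
    dualSeq n (Q.map φ) l = φ (dualSeq n Q l) := by
  simp [dualSeq]

/-- The factorials in `dualSeq` convert the binomial coefficients of (X - ξ)^l into the descending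
factorials of a derivative of order n - l. -/
theorem moment_dualSeq (n : ℕ) (Q : F[X]) (hQ : Q.natDegree ≤ n) (ξ : F) {l : ℕ} (hl : l ≤ n) :
    moment (dualSeq n Q) ((X - C ξ) ^ l) =
      (-1) ^ l * l.factorial * (derivative^[n - l] Q).eval ξ := by
  have hd : (derivative^[n - l] Q).natDegree < l + 1 := by
    have := natDegree_iterate_derivative Q (n - l); omega
  rw [moment_eq_sum_range _ (N := l + 1) (by
    rw [natDegree_pow, natDegree_X_sub_C, mul_one]; exact Nat.lt_succ_self l),
    eval_eq_sum_range' hd, Finset.mul_sum,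
    ← Finset.sum_range_reflect (fun i => _ * ((derivative^[n - l] Q).coeff i * ξ ^ i)) (l + 1)]
  refine Finset.sum_congr rfl fun i hi => ?_
  have hil : i ≤ l := Nat.lt_succ_iff.1 (Finset.mem_range.1 hi)
  have e1 : l + 1 - 1 - i = l - i := by omega
  have e2 : l - i + (n - l) = n - i := by omega
  rw [e1, coeff_iterate_derivative, e2, sub_eq_add_neg, ← C_neg, coeff_X_add_C_pow, dualSeq]
  have f1 : ((l - i).factorial : F) * ((n - i).descFactorial (n - l) : F) = (n - i).factorial := by
    have := Nat.factorial_mul_descFactorial (show n - l ≤ n - i by omega)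
    rw [show n - i - (n - l) = l - i by omega] at this
    rw [← this, Nat.cast_mul]
  have f2 : ((l.choose i : ℕ) : F) * i.factorial * (l - i).factorial = l.factorial := by
    rw [← Nat.choose_mul_factorial_mul_factorial hil, Nat.cast_mul, Nat.cast_mul]
  have f3 : (-ξ) ^ (l - i) * (-1) ^ i = (-1) ^ l * ξ ^ (l - i) := by
    rw [neg_pow, mul_right_comm, ← pow_add, Nat.sub_add_cancel hil]
  rw [nsmul_eq_mul, ← f1, ← f2]
  linear_combination ((l.choose i : F) * i.factorial * (l - i).factorial *
    (n - i).descFactorial (n - l) * Q.coeff (n - i)) * f3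

end Moment

/-! ### Hankel determinants -/

section Hankel

variable {F : Type*} [NormedField F]

theorem prod_ite_lt {p t : ℕ} (ht : t ≤ p) (x y : ℝ) :
    ∏ β : Fin p, (if (β : ℕ) < t then x else y) = x ^ t * y ^ (p - t) := by
  rw [Fin.prod_univ_eq_prod_range (fun β => if β < t then x else y) p,
    ← Finset.prod_range_mul_prod_Ico _ ht]
  congr 1
  · rw [Finset.prod_congr rfl fun β hβ => if_pos (Finset.mem_range.1 hβ)]; simp
  · rw [Finset.prod_congr rfl fun β hβ => if_neg (not_lt.2 (Finset.mem_Ico.1 hβ).1)]; simp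

theorem toeplitz_zero (g : ℕ → F) (i : ℕ) : toeplitz g i 0 = 1 := by
  rw [toeplitz, Matrix.det_fin_zero]

theorem skip_le (i q β : ℕ) : skip i q β ≤ β + q := by
  rw [skip]; split_ifs <;> omega

/-- A bound for Hankel determinants of sequences satisfying a linear recurrence. -/
theorem norm_hankel_mul_pow_le (n : ℕ) (hn : 1 ≤ n) (a : ℕ → F) (g : F[X]) (hg : g ≠ 0) (m L : ℕ)
    (hL : g.natDegree + L ≤ m + 2) (hLn : L ≤ n) (hm : m + g.natDegree ≤ n)
    (hrec : ∀ l ≤ m, ∑ j ∈ Finset.range (g.natDegree + 1), g.coeff j * a (l + j) = 0)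
    {A : ℝ} (ha : ∀ l ≤ n, ‖a l‖ ≤ A) :
    ‖(Matrix.of fun α β : Fin g.natDegree => a (α + β)).det‖ *
        (threshold n (n + 1) * gaussN 1 g ^ L) ≤
      ‖g.leadingCoeff‖ ^ L * (g.natDegree.factorial * A ^ g.natDegree) := by
  obtain ⟨i, hi, -, htoep⟩ := exists_dominant_coeff n hn one_pos g hg (by omega)
  -- Row indices are at most r - 1 and shifts at most L - 1, so the recurrence is used up to r + L -
  -- 2 ≤ m.
  have h := norm_det_mul_norm_toeplitz a g.coeff g.natDegree i L hi
    (fun j hj => coeff_eq_zero_of_natDegree_lt hj) (fun α => α)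
    (fun α s hs => hrec _ (by have := α.2; omega))
  have ht := htoep L hLn
  rw [one_pow, mul_one] at ht
  refine (mul_le_mul_of_nonneg_left ht (norm_nonneg _)).trans (h.trans_le ?_)
  refine mul_le_mul_of_nonneg_left ?_ (by positivity)
  have := norm_det_le_of_col_le (Matrix.of fun α β : Fin g.natDegree => a (α + skip i L β))
    (fun _ => A) (fun α β => ha _ (by
      have := α.2; have := β.2; have := skip_le i L β; omega))
  simpa using this

theorem norm_hankel_mul_pow_le_of_ultrametric [IsUltrametricDist F] (n : ℕ) (a : ℕ → F) (g : F[X])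
    (hg : g ≠ 0) (m L : ℕ) (hL : g.natDegree + L ≤ m + 2) (hm : m + g.natDegree ≤ n)
    (hrec : ∀ l ≤ m, ∑ j ∈ Finset.range (g.natDegree + 1), g.coeff j * a (l + j) = 0)
    (ha : ∀ l ≤ n, ‖a l‖ ≤ 1) :
    ‖(Matrix.of fun α β : Fin g.natDegree => a (α + β)).det‖ * gaussN 1 g ^ L ≤
      ‖g.leadingCoeff‖ ^ L := by
  obtain ⟨i, hi, -, htoep⟩ := exists_dominant_coeff_of_ultrametric g hg
  have h := norm_det_mul_norm_toeplitz a g.coeff g.natDegree i L hi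
    (fun j hj => coeff_eq_zero_of_natDegree_lt hj) (fun α => α)
    (fun α s hs => hrec _ (by have := α.2; omega))
  refine (mul_le_mul_of_nonneg_left (htoep L) (norm_nonneg _)).trans (h.trans_le ?_)
  refine mul_le_of_le_one_right (by positivity) ?_
  have := norm_det_le_of_col_le_of_ultrametric
    (Matrix.of fun α β : Fin g.natDegree => a (α + skip i L β))
    (fun _ => 1) (fun _ => zero_le_one) (fun α β => ha _ (by
      have := α.2; have := β.2; have := skip_le i L β; omega))
  simpa using this

/-- The constant in `log_norm_hankel_le`. -/
noncomputable def hankelConst (n : ℕ) : ℝ :=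
  Real.log n.factorial - (n + 2) * Real.log (threshold n (n + 1))

theorem log_threshold_nonpos (n j : ℕ) : Real.log (threshold n j) ≤ 0 :=
  Real.log_nonpos (threshold_pos n j).le (threshold_le_one n j)

theorem log_factorial_nonneg (n : ℕ) : 0 ≤ Real.log n.factorial :=
  Real.log_nonneg (by exact_mod_cast n.factorial_pos)

theorem hankelConst_nonneg (n : ℕ) : 0 ≤ hankelConst n := by
  have := log_factorial_nonneg n
  have := log_threshold_nonpos n (n + 1)
  rw [hankelConst]
  nlinarith [n.cast_nonneg (α := ℝ)]

/-- A bound for Hankel determinants of sequences satisfying a linear recurrence, and which are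
small except for their first `t` terms. -/
theorem log_norm_hankel_le (n : ℕ) (hn : 1 ≤ n) (a : ℕ → F) (g : F[X]) (hg : g ≠ 0) (m L t : ℕ)
    (hL : g.natDegree + L ≤ m + 2) (hLn : L ≤ n) (htL : t ≤ L) (hm : m + g.natDegree ≤ n)
    (hrec : ∀ l ≤ m, ∑ j ∈ Finset.range (g.natDegree + 1), g.coeff j * a (l + j) = 0)
    {Y Z ν : ℝ} (hν : 0 ≤ ν) (hZ : 0 < Z) (hY : 0 < Y) (hYZ : Real.log Y = Real.log Z + t * ν)
    (hbig : ∀ l < t, ‖a l‖ ≤ Y) (hsmall : ∀ l, t ≤ l → l ≤ n → ‖a l‖ ≤ Z)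
    (hD : (Matrix.of fun α β : Fin g.natDegree => a (α + β)).det ≠ 0) :
    Real.log ‖(Matrix.of fun α β : Fin g.natDegree => a (α + β)).det‖ +
        L * Real.log (gaussN 1 g) ≤
      L * Real.log ‖g.leadingCoeff‖ +
        t * (Real.log (gaussN 1 g) - Real.log (gaussN (Real.exp (-ν)) g)) +
        g.natDegree * Real.log Z + hankelConst n := by
  set r := g.natDegree with hr
  set S := gaussN 1 g with hS
  set S' := gaussN (Real.exp (-ν)) g with hS'
  set κ := threshold n (n + 1) with hκ
  have hκ0 : 0 < κ := threshold_pos _ _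
  have hκ1 : Real.log κ ≤ 0 := log_threshold_nonpos _ _
  have hS0 : 0 < S := gaussN_pos one_pos hg
  have hS'0 : 0 < S' := gaussN_pos (Real.exp_pos _) hg
  have hrn : r ≤ n := by omega
  have htn : t ≤ n := by omega
  have hgr : 0 < ‖g.leadingCoeff‖ := norm_pos_iff.2 (leadingCoeff_ne_zero.2 hg)
  have hZY : Z ≤ Y := by
    rw [← Real.log_le_log_iff hZ hY, hYZ]
    have : 0 ≤ (t : ℝ) * ν := by positivity
    linarith
  -- the index of the first reduction
  obtain ⟨i, q, hi, hiq, hdrop, htoep0, htoep⟩ : ∃ i q : ℕ, i ≤ r ∧ i + q = t ∧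
      i * ν + Real.log κ ≤ Real.log S - Real.log S' ∧ toeplitz g.coeff i q ≠ 0 ∧
      Real.log κ + q * Real.log S' + i * q * ν ≤ Real.log ‖toeplitz g.coeff i q‖ := by
    obtain ⟨i, hi, hdom, htoep⟩ := exists_dominant_coeff n hn (Real.exp_pos (-ν)) g hg hrn
    have hdrop : i * ν + Real.log κ ≤ Real.log S - Real.log S' := by
      have h1 : κ * S' ≤ S * Real.exp (-ν) ^ i :=
        hdom.trans (mul_le_mul_of_nonneg_right (norm_coeff_le_gaussN g i) (by positivity))
      have h2 := Real.log_le_log (by positivity) h1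
      rw [Real.log_mul hκ0.ne' hS'0.ne', Real.log_mul hS0.ne' (by positivity), Real.log_pow,
        Real.log_exp] at h2
      linarith
    rcases le_total i t with hit | hit
    · have h1 := htoep (t - i) (by omega)
      have h0 : toeplitz g.coeff i (t - i) ≠ 0 := by
        intro h0
        rw [h0, norm_zero, zero_mul] at h1
        have : 0 < κ * S' ^ (t - i) := by positivity
        linarith
      refine ⟨i, t - i, hi, by omega, hdrop, h0, ?_⟩
      have h2 := Real.log_le_log (by positivity) h1
      rw [Real.log_mul hκ0.ne' (by positivity), Real.log_mul (norm_ne_zero_iff.2 h0) (by positivity),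
        Real.log_pow, Real.log_pow, Real.log_exp] at h2
      push_cast at h2 ⊢
      linarith
    -- If the dominant index is at least t, nothing is skipped in the first reduction.
    · refine ⟨t, 0, by omega, rfl, ?_, ?_, ?_⟩
      · have : (t : ℝ) * ν ≤ i * ν := by gcongr
        linarith
      · rw [toeplitz_zero]; exact one_ne_zero
      · rw [toeplitz_zero]; simpa using hκ1
  -- The L skipped indices are shared: q on one side of the matrix, where G is measured at radius
  -- exp(-ν), and s on the other, at radius 1.
  obtain ⟨s, hs⟩ : ∃ s, q + s = L := ⟨L - q, by omega⟩
  obtain ⟨i', hi', -, htoep'⟩ := exists_dominant_coeff n hn one_pos g hg hrn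
  have htoep' := htoep' s (by omega)
  rw [one_pow, mul_one, ← hS] at htoep'
  have htoep'0 : 0 < ‖toeplitz g.coeff i' s‖ := lt_of_lt_of_le (by positivity) htoep'
  have e1 := norm_det_mul_norm_toeplitz a g.coeff r i q hi
    (fun j hj => coeff_eq_zero_of_natDegree_lt hj) (fun α => α)
    (fun α s hs => hrec _ (by have := α.2; omega))
  have e2 := norm_det_mul_norm_toeplitz a g.coeff r i' s hi'
    (fun j hj => coeff_eq_zero_of_natDegree_lt hj) (fun α => skip i q α)
    (fun α s' hs' => hrec _ (by have := α.2; have := skip_le i q α; omega))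
  have htr : (Matrix.of fun α β : Fin r => a (α + skip i q β)).det =
      (Matrix.of fun α β : Fin r => a (skip i q α + β)).det := by
    rw [← Matrix.det_transpose]
    congr 1
    ext α β
    simp [add_comm]
  rw [htr] at e1
  set D := (Matrix.of fun α β : Fin r => a (α + β)).det
  set D1 := (Matrix.of fun α β : Fin r => a (skip i q α + β)).det
  set D2 := (Matrix.of fun α β : Fin r => a (skip i q α + skip i' s β)).det with hD2
  have e3 : ‖D‖ * ‖toeplitz g.coeff i q‖ * ‖toeplitz g.coeff i' s‖ =
      ‖g.leadingCoeff‖ ^ L * ‖D2‖ := by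
    rw [e1, mul_assoc, e2, ← mul_assoc, ← pow_add, hs]; rfl
  -- Once [i, t) is skipped, only the first i columns can meet the t large terms.
  have hbound : ‖D2‖ ≤ r.factorial * (Y ^ i * Z ^ (r - i)) := by
    have := norm_det_le_of_col_le (Matrix.of fun α β : Fin r => a (skip i q β + skip i' s α))
      (fun β => if (β : ℕ) < i then Y else Z) (fun α β => by
        have h1 := α.2
        have h2 := β.2
        have h3 := skip_le i q β
        have h4 := skip_le i' s α
        rw [Matrix.of_apply]
        by_cases hβ : (β : ℕ) < i
        · simp only [hβ, if_true]
          by_cases hlt : skip i q β + skip i' s α < t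
          · exact hbig _ hlt
          · exact (hsmall _ (by omega) (by omega)).trans hZY
        · simp only [hβ, if_false]
          have : skip i q β = β + q := if_neg hβ
          exact hsmall _ (by omega) (by omega))
    rw [prod_ite_lt hi, Fintype.card_fin] at this
    rw [hD2, ← Matrix.det_transpose]
    exact this
  have hDpos : 0 < ‖D‖ := norm_pos_iff.2 hD
  have htoeppos : 0 < ‖toeplitz g.coeff i q‖ := norm_pos_iff.2 htoep0
  have hD2pos : 0 < ‖D2‖ := by
    have : 0 < ‖g.leadingCoeff‖ ^ L * ‖D2‖ := by rw [← e3]; positivity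
    exact pos_of_mul_pos_right this (by positivity)
  have l1 := congrArg Real.log e3
  rw [Real.log_mul (by positivity) htoep'0.ne', Real.log_mul hDpos.ne' htoeppos.ne',
    Real.log_mul (by positivity) hD2pos.ne', Real.log_pow] at l1
  have l2 := Real.log_le_log hD2pos hbound
  have hfac : (r.factorial : ℝ) ≠ 0 := by exact_mod_cast r.factorial_ne_zero
  rw [Real.log_mul hfac (by positivity), Real.log_mul (by positivity) (by positivity),
    Real.log_pow, Real.log_pow, hYZ] at l2
  have l3 := Real.log_le_log (by positivity) htoep'
  rw [Real.log_mul hκ0.ne' (by positivity), Real.log_pow] at l3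
  have l4 : Real.log r.factorial ≤ Real.log n.factorial :=
    Real.log_le_log (by exact_mod_cast r.factorial_pos)
      (by exact_mod_cast Nat.factorial_le hrn)
  -- The i large columns cost i t ν and the first Toeplitz determinant returns i q ν. The remaining
  -- i · iν is at most i (log S - log S') up to a constant. Replacing q log S' by q log S costs q
  -- (log S - log S'), for a total of t = i + q such differences.
  have l5 := mul_le_mul_of_nonneg_left hdrop (i.cast_nonneg (α := ℝ))
  have l6 : (n : ℝ) * Real.log κ ≤ i * Real.log κ :=
    mul_le_mul_of_nonpos_right (by exact_mod_cast (by omega : i ≤ n)) hκ1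
  have c1 : ((r - i : ℕ) : ℝ) = r - i := by rw [Nat.cast_sub hi]
  have c2 : (t : ℝ) = i + q := by exact_mod_cast hiq.symm
  have c3 : (L : ℝ) = q + s := by exact_mod_cast hs.symm
  rw [c1, c2] at l2
  rw [c3] at l1 ⊢
  rw [hankelConst, ← hκ, c2]
  linarith

/-- The coefficients of the polynomials `(X + ξ) ^ f` with `f ≤ n` are bounded by this constant. -/
noncomputable def transConst (n : ℕ) (ξ : F) : ℝ :=
  ∑ f ∈ Finset.range (n + 1), gaussN 1 (taylor ξ (X ^ f : F[X]))

theorem norm_coeff_taylor_X_pow_le {n f : ℕ} (hf : f ≤ n) (ξ : F) (j : ℕ) :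
    ‖(taylor ξ (X ^ f : F[X])).coeff j‖ ≤ transConst n ξ :=
  (norm_coeff_le_gaussN _ _).trans (Finset.single_le_sum
    (f := fun f => gaussN 1 (taylor ξ (X ^ f : F[X])))
    (fun _ _ => gaussN_nonneg zero_le_one _) (Finset.mem_range.2 (by omega)))

theorem one_le_transConst (n : ℕ) (ξ : F) : 1 ≤ transConst n ξ := by
  have := norm_coeff_taylor_X_pow_le (Nat.zero_le n) ξ 0
  simpa using this

/-- Expanding X^f around ξ involves only moments of index between β and f + β, so columns with β ≥ t
stay small. -/
theorem norm_moment_X_pow_mul_le (n : ℕ) (ξ : F) (q : ℕ → F) (f β : ℕ) (hf : f + β ≤ n) {E : ℝ}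
    (hE : ∀ l, β ≤ l → l ≤ n → ‖moment q ((X - C ξ) ^ l)‖ ≤ E) :
    ‖moment q (X ^ f * (X - C ξ) ^ β)‖ ≤ (n + 1) * transConst n ξ * E := by
  have hE0 : 0 ≤ E := (norm_nonneg _).trans (hE β le_rfl (by omega))
  have hT := one_le_transConst n ξ
  rw [moment_mul_eq_sum q _ _ ξ (N := n + 1) (by rw [natDegree_X_pow]; omega)]
  have : ∀ j ∈ Finset.range (n + 1), ‖(taylor ξ (X ^ f : F[X])).coeff j *
      moment q ((X - C ξ) ^ j * (X - C ξ) ^ β)‖ ≤ transConst n ξ * E := by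
    intro j _
    by_cases hj : j ≤ f
    · rw [norm_mul, ← pow_add]
      exact mul_le_mul (norm_coeff_taylor_X_pow_le (by omega) ξ j)
        (hE _ (by omega) (by omega)) (norm_nonneg _) (by linarith)
    · rw [coeff_eq_zero_of_natDegree_lt (by rw [natDegree_taylor, natDegree_X_pow]; omega)]
      simp; positivity
  refine (norm_sum_le_of_le _ this).trans_eq ?_
  simp; ring

/-- A bound for minors of Hankel matrices of sequences whose translated moments are small, except
for the first `t`. -/
theorem norm_minor_le (n : ℕ) (ξ : F) (q : ℕ → F) {p t : ℕ} (htp : t ≤ p) (f : Fin p → ℕ)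
    (hf : ∀ α, ∀ β : Fin p, f α + β ≤ n) {Y Z : ℝ} (hZY : Z ≤ Y)
    (hbig : ∀ l < t, ‖moment q ((X - C ξ) ^ l)‖ ≤ Y)
    (hsmall : ∀ l, t ≤ l → l ≤ n → ‖moment q ((X - C ξ) ^ l)‖ ≤ Z) :
    ‖(Matrix.of fun α β : Fin p => q (f α + β)).det‖ ≤
      p.factorial * (((n + 1) * transConst n ξ * Y) ^ t *
        ((n + 1) * transConst n ξ * Z) ^ (p - t)) := by
  have h1 : (Matrix.of fun α β : Fin p => q (f α + β)) =
      Matrix.of fun α β : Fin p => moment q (X ^ (β : ℕ) * X ^ (f α)) := by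
    ext α β
    rw [Matrix.of_apply, Matrix.of_apply, ← pow_add, moment_X_pow, add_comm]
  rw [h1, ← det_moment_mul_X_sub_C_pow q ξ fun α => X ^ (f α)]
  have := norm_det_le_of_col_le
    (Matrix.of fun α β : Fin p => moment q ((X - C ξ) ^ (β : ℕ) * X ^ (f α)))
    (fun β => if (β : ℕ) < t then (n + 1) * transConst n ξ * Y else (n + 1) * transConst n ξ * Z)
    (fun α β => by
      rw [Matrix.of_apply, mul_comm]
      have hαβ := hf α β
      split_ifs with hβ
      · refine norm_moment_X_pow_mul_le n ξ q _ _ hαβ fun l _ hl => ?_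
        by_cases hlt : l < t
        · exact hbig l hlt
        · exact (hsmall l (by omega) hl).trans hZY
      · exact norm_moment_X_pow_mul_le n ξ q _ _ hαβ fun l hl hln =>
          hsmall l (by omega) hln)
  rwa [prod_ite_lt htp, Fintype.card_fin] at this

end Hankel

/-! ### Sequences with small moments -/

section SmallMoments

variable {K : Type u} [Field K] [NumberField K] (w : Place K) (ξ : w.Completion)

/-- The moments of `(X - ξ) ^ l` over `K_w`, and of `X ^ l` over the other completions. -/
noncomputable def locMoment (v : Place K) (q : ℕ → K) (l : ℕ) : v.Completion :=
  moment (fun l => algebraMap K v.Completion (q l)) ((X - C (center w ξ v)) ^ l)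

theorem center_of_ne {v : Place K} (hv : v ≠ w) : center w ξ v = 0 := by
  simp [center, hv]

theorem center_self : center w ξ w = ξ := by
  simp [center]

theorem locMoment_of_ne {v : Place K} (hv : v ≠ w) (q : ℕ → K) (l : ℕ) :
    locMoment w ξ v q l = algebraMap K v.Completion (q l) := by
  rw [locMoment, center_of_ne w ξ hv, C_0, sub_zero, moment_X_pow]

theorem algebraMap_det (v : Place K) (q : ℕ → K) {p : ℕ} (f : Fin p → ℕ) :
    algebraMap K v.Completion (Matrix.of fun α β : Fin p => q (f α + β)).det =
      (Matrix.of fun α β : Fin p => algebraMap K v.Completion (q (f α + β))).det := by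
  rw [RingHom.map_det]; rfl

/-- One global determinant is computed at every place with the local center. -/
theorem algebraMap_hankel (v : Place K) (q : ℕ → K) (r : ℕ) :
    algebraMap K v.Completion (Matrix.of fun α β : Fin r => q ((α : ℕ) + β)).det =
      (Matrix.of fun α β : Fin r => locMoment w ξ v q ((α : ℕ) + β)).det := by
  rw [algebraMap_det v q fun α => α]
  exact (det_moment_X_sub_C_pow (fun l => algebraMap K v.Completion (q l))
    (center w ξ v) r).symm

theorem locMoment_recurrence (v : Place K) (q : ℕ → K) (G : K[X]) {m : ℕ}
    (h : ∀ l ≤ m, moment q (G * X ^ l) = 0) (l : ℕ) (hl : l ≤ m) :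
    ∑ j ∈ Finset.range ((locPoly w ξ v G).natDegree + 1),
      (locPoly w ξ v G).coeff j * locMoment w ξ v q (l + j) = 0 := by
  have h1 : ∀ l ≤ m, moment (fun l => algebraMap K v.Completion (q l))
      (G.map (algebraMap K v.Completion) * X ^ l) = 0 := fun l hl => by
    have := moment_map (algebraMap K v.Completion) q (G * X ^ l)
    rwa [Polynomial.map_mul, Polynomial.map_pow, map_X, h l hl, map_zero] at this
  have h2 := moment_mul_eq_zero _ _ h1 ((X - C (center w ξ v)) ^ l)
    (by rw [natDegree_pow, natDegree_X_sub_C, mul_one]; exact hl)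
  rw [moment_mul_eq_sum _ _ _ (center w ξ v) (N := G.natDegree + 1)
    (by rw [natDegree_map]; exact Nat.lt_succ_self _)] at h2
  rw [natDegree_locPoly, ← h2]
  refine Finset.sum_congr rfl fun j _ => ?_
  rw [locMoment, ← pow_add, add_comm l j]; rfl

/-- The sequence `q` is small at all places, except for its first `t` translated moments
at `w`. -/
structure SmallMoments (n t : ℕ) (A Y Z : ℝ) (q : ℕ → K) : Prop where
  arch : ∀ v, Place.arch v ≠ w → ∀ l ≤ n, ‖algebraMap K (Place.arch v).Completion (q l)‖ ≤ A
  ultra : ∀ v, Place.ultra v ≠ w → ∀ l ≤ n, ‖algebraMap K (Place.ultra v).Completion (q l)‖ ≤ 1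
  big : ∀ l < t, ‖locMoment w ξ w q l‖ ≤ Y
  small : ∀ l, t ≤ l → l ≤ n → ‖locMoment w ξ w q l‖ ≤ Z

theorem Place.product_formula_le {x : K} (hx : x ≠ 0) {C B : ℝ} (hC : 0 ≤ C)
    (hv : ∀ v ≠ w, v.weight * Real.log ‖algebraMap K v.Completion x‖ ≤ v.archConst C)
    (hw : w.weight * Real.log ‖algebraMap K w.Completion x‖ ≤ B) :
    0 ≤ Fintype.card (NumberField.InfinitePlace K) * C + B := by
  have := Place.finsum_le_of_le w _ (Place.support_log_norm_algebraMap hx) hC hv hw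
  rwa [Place.finsum_log_norm_algebraMap hx] at this

theorem Place.weight_mul_log_le {v : Place K} {x : K} (hx : x ≠ 0) {B b : ℝ} (hb : 0 ≤ b)
    (hB : Real.log B ≤ b) (h : ‖algebraMap K v.Completion x‖ ≤ B) :
    v.weight * Real.log ‖algebraMap K v.Completion x‖ ≤ 2 * b := by
  have h0 : 0 < ‖algebraMap K v.Completion x‖ := by
    rw [norm_pos_iff, Ne, map_eq_zero]; exact hx
  have h1 : Real.log ‖algebraMap K v.Completion x‖ ≤ b := (Real.log_le_log h0 h).trans hB
  rcases le_total 0 (Real.log ‖algebraMap K v.Completion x‖) with h2 | h2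
  · exact mul_le_mul v.weight_le_two h1 h2 zero_le_two
  · exact (mul_nonpos_of_nonneg_of_nonpos v.weight_pos.le h2).trans (by positivity)

/-- The constant which forces Hankel minors to vanish. -/
noncomputable def minorConst (n : ℕ) (A : ℝ) : ℝ :=
  Fintype.card (NumberField.InfinitePlace K) *
      (2 * (Real.log (n + 1).factorial + (n + 1) * Real.log A)) +
    2 * (Real.log (n + 1).factorial +
      (n + 1) * (Real.log ((n + 1) * transConst n ξ) + Real.log A))

theorem log_trans_nonneg (n : ℕ) : 0 ≤ Real.log ((n + 1) * transConst n ξ) :=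
  Real.log_nonneg (one_le_mul_of_one_le_of_one_le (by linarith [n.cast_nonneg (α := ℝ)])
    (one_le_transConst n ξ))

variable {w ξ}

/-- At w the large columns contribute t(p-t)x and the small ones -(p-t)(tx+γ). The scale x cancels,
and the remaining -(p-t)γ ≤ -γ outweighs all constants, so a nonzero minor would violate the product
formula. -/
theorem SmallMoments.det_eq_zero {n t p : ℕ} {A x γ : ℝ} {q : ℕ → K} (hA : 1 ≤ A) (hx : 0 ≤ x)
    (htp : t < p) (hpn : p ≤ n + 1) (hγ : minorConst w ξ n A < γ)
    (h : SmallMoments w ξ n t A (A * Real.exp ((p - t) * x / w.weight))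
      (A * Real.exp (-(t * x + γ) / w.weight)) q)
    (f : Fin p → ℕ) (hf : ∀ α, ∀ β : Fin p, f α + β ≤ n) :
    (Matrix.of fun α β : Fin p => q (f α + β)).det = 0 := by
  by_contra hdet
  have hA0 : 0 < A := by linarith
  have hlA : 0 ≤ Real.log A := Real.log_nonneg hA
  have hlB := log_trans_nonneg w ξ n
  have hB0 : 0 < (n + 1) * transConst n ξ := by
    have := one_le_transConst n ξ; positivity
  have hw := w.weight_pos
  have hfac : (0 : ℝ) < p.factorial := by exact_mod_cast p.factorial_pos
  have hlf : Real.log p.factorial ≤ Real.log (n + 1).factorial :=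
    Real.log_le_log hfac (by exact_mod_cast Nat.factorial_le hpn)
  have hlf0 := log_factorial_nonneg p
  have hpn' : (p : ℝ) ≤ n + 1 := by exact_mod_cast hpn
  have htp' : (t : ℝ) + 1 ≤ p := by exact_mod_cast htp
  have hγ0 : 0 ≤ γ := by
    refine le_trans ?_ hγ.le
    rw [minorConst]; positivity
  have hZY : A * Real.exp (-(t * x + γ) / w.weight) ≤ A * Real.exp ((p - t) * x / w.weight) := by
    gcongr
    nlinarith
  have key := Place.product_formula_le w hdet
    (C := 2 * (Real.log (n + 1).factorial + (n + 1) * Real.log A))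
    (B := 2 * (Real.log (n + 1).factorial +
      (n + 1) * (Real.log ((n + 1) * transConst n ξ) + Real.log A)) - (p - t) * γ)
    (by positivity) ?_ ?_
  · have : γ ≤ (p - t) * γ := le_mul_of_one_le_left hγ0 (by linarith)
    rw [minorConst] at hγ
    linarith
  · intro v hv
    cases v with
    | arch v =>
      refine Place.weight_mul_log_le hdet (B := p.factorial * A ^ p) (by positivity) ?_ ?_
      · rw [Real.log_mul hfac.ne' (by positivity), Real.log_pow]
        have : (p : ℝ) * Real.log A ≤ (n + 1) * Real.log A := by gcongr
        linarith
      · rw [algebraMap_det]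
        have := norm_det_le_of_col_le (Matrix.of fun α β : Fin p =>
          algebraMap K (Place.arch v).Completion (q (f α + β))) (fun _ => A)
          (fun α β => h.arch v hv _ (hf α β))
        simpa using this
    | ultra v =>
      have : ‖algebraMap K (Place.ultra v).Completion
          (Matrix.of fun α β : Fin p => q (f α + β)).det‖ ≤ 1 := by
        rw [algebraMap_det]
        have := norm_det_le_of_col_le_of_ultrametric (Matrix.of fun α β : Fin p =>
          algebraMap K (Place.ultra v).Completion (q (f α + β))) (fun _ => 1)
          (fun _ => zero_le_one) (fun α β => h.ultra v hv _ (hf α β))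
        simpa using this
      exact mul_nonpos_of_nonneg_of_nonpos (Place.weight_pos _).le
        (Real.log_nonpos (norm_nonneg _) this)
  · have hb := h.big
    have hs := h.small
    simp only [locMoment, center_self] at hb hs
    have h1 := norm_minor_le n ξ _ htp.le f hf hZY hb hs
    rw [← algebraMap_det] at h1
    have h0 : 0 < ‖algebraMap K w.Completion (Matrix.of fun α β : Fin p => q (f α + β)).det‖ := by
      rw [norm_pos_iff, Ne, map_eq_zero]; exact hdet
    have h2 := Real.log_le_log h0 h1
    rw [Real.log_mul hfac.ne' (by positivity), Real.log_mul (by positivity) (by positivity),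
      Real.log_pow, Real.log_pow, Real.log_mul hB0.ne' (by positivity),
      Real.log_mul hB0.ne' (by positivity), Real.log_mul hA0.ne' (by positivity),
      Real.log_mul hA0.ne' (by positivity), Real.log_exp, Real.log_exp, Nat.cast_sub htp.le] at h2
    have h3 := mul_le_mul_of_nonneg_left h2 hw.le
    have h4 : w.weight * (Real.log p.factorial +
        (t * (Real.log ((n + 1) * transConst n ξ) + (Real.log A + (p - t) * x / w.weight)) +
          (p - t) * (Real.log ((n + 1) * transConst n ξ) +
            (Real.log A + -(t * x + γ) / w.weight)))) =
        w.weight * (Real.log p.factorial +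
          p * (Real.log ((n + 1) * transConst n ξ) + Real.log A)) - (p - t) * γ := by
      field_simp; ring
    have h5 : w.weight * (Real.log p.factorial +
          p * (Real.log ((n + 1) * transConst n ξ) + Real.log A)) ≤
        2 * (Real.log (n + 1).factorial +
          (n + 1) * (Real.log ((n + 1) * transConst n ξ) + Real.log A)) := by
      refine mul_le_mul w.weight_le_two ?_ (by positivity) zero_le_two
      gcongr
    linarith

/-- A sequence all of whose moments are small vanishes. -/
theorem SmallMoments.eq_zero {n : ℕ} {A x γ Y : ℝ} {q : ℕ → K} (hA : 1 ≤ A) (hx : 0 ≤ x)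
    (hγ : minorConst w ξ n A < γ)
    (h : SmallMoments w ξ n 0 A Y (A * Real.exp (-(x + γ) / w.weight)) q) :
    ∀ l ≤ n, q l = 0 := by
  intro l hl
  have h' : SmallMoments w ξ n 0 A (A * Real.exp (((1 : ℕ) - (0 : ℕ)) * x / w.weight))
      (A * Real.exp (-((0 : ℕ) * x + γ) / w.weight)) q :=
    { arch := h.arch
      ultra := h.ultra
      big := fun l hl => absurd hl (Nat.not_lt_zero l)
      small := fun l h1 h2 => (h.small l h1 h2).trans (by
        have := w.weight_pos
        push_cast
        gcongr
        linarith) }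
  have := h'.det_eq_zero (p := 1) hA hx one_pos (by omega) hγ (fun _ => l)
    (fun α β => by have := β.2; omega)
  simpa using this

theorem SmallMoments.exists_recurrence {n k t : ℕ} {A x γ : ℝ} {q : ℕ → K} (hA : 1 ≤ A)
    (hx : 0 ≤ x) (htk : t ≤ k) (hkn : 4 * k ≤ n) (hγ : minorConst w ξ n A < γ)
    (h : SmallMoments w ξ n t A (A * Real.exp ((k + 1 - t) * x / w.weight))
      (A * Real.exp (-(t * x + γ) / w.weight)) q) (hq : ∃ l ≤ n, q l ≠ 0) :
    ∃ G : K[X], G ≠ 0 ∧ 0 < G.natDegree ∧ G.natDegree ≤ k ∧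
      (∀ l ≤ n - k, moment q (G * X ^ l) = 0) ∧
      (Matrix.of fun α β : Fin G.natDegree => q ((α : ℕ) + β)).det ≠ 0 := by
  obtain ⟨G, hG0, hGk, hG, hD⟩ := RoyWaldschmidt.exists_recurrence q k (n - k) fun f hf =>
    SmallMoments.det_eq_zero (p := k + 1) hA hx (Nat.lt_succ_of_le htk) (by omega) hγ
      (by push_cast; exact h) f (fun α β => by have := hf α; have := β.2; omega)
  -- A constant G would annihilate the moments up to n - k. The later ones are small because n - k ≥
  -- t, and then the whole sequence would vanish.
  refine ⟨G, hG0, Nat.pos_of_ne_zero fun hr => ?_, hGk, hG, hD⟩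
  have hG1 : locPoly w ξ w G = C ((locPoly w ξ w G).coeff 0) :=
    eq_C_of_natDegree_eq_zero (by rw [natDegree_locPoly, hr])
  have hcoeff : (locPoly w ξ w G).coeff 0 ≠ 0 := fun h0 =>
    locPoly_ne_zero w ξ w hG0 (by rw [hG1, h0, C_0])
  have hzero : ∀ l ≤ n - k, locMoment w ξ w q l = 0 := fun l hl => by
    have := locMoment_recurrence w ξ w q G hG l hl
    rw [natDegree_locPoly, hr, zero_add, Finset.sum_range_one, add_zero] at this
    exact (mul_eq_zero.1 this).resolve_left hcoeff
  have hall : SmallMoments w ξ n 0 A (A * Real.exp ((k + 1 - t) * x / w.weight))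
      (A * Real.exp (-(t * x + γ) / w.weight)) q :=
    { arch := h.arch
      ultra := h.ultra
      big := fun l hl => absurd hl (Nat.not_lt_zero l)
      small := fun l _ hln => by
        by_cases hl : l ≤ n - k
        · rw [hzero l hl, norm_zero]; positivity
        · exact h.small l (by omega) hln }
  obtain ⟨l, hl, hl0⟩ := hq
  exact hl0 (hall.eq_zero hA (by positivity) hγ l hl)

/-- The constant in `SmallMoments.le_drop`. -/
noncomputable def dropConst (K : Type u) [Field K] [NumberField K] (n : ℕ) (A : ℝ) : ℝ :=
  Fintype.card (NumberField.InfinitePlace K) *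
      (2 * (Real.log n.factorial + n * Real.log A - Real.log (threshold n (n + 1)))) +
    2 * (n * Real.log A + hankelConst n)

/-- The local bounds for D, summed over all places, give L h(G) + t r x ≤ t drop(G) + O(1), because
D and the leading coefficient of G drop out by the product formula. It remains to divide by t. -/
theorem SmallMoments.le_drop {n k t : ℕ} {A x : ℝ} {q : ℕ → K} (hA : 1 ≤ A) (hx : 0 ≤ x)
    (ht : 1 ≤ t) (htk : t ≤ k) (hkn : 4 * k ≤ n)
    (h : SmallMoments w ξ n t A (A * Real.exp ((k + 1 - t) * x / w.weight))
      (A * Real.exp (-(t * x) / w.weight)) q)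
    (G : K[X]) (hG0 : G ≠ 0) (hr : 0 < G.natDegree) (hGk : G.natDegree ≤ k)
    (hG : ∀ l ≤ n - k, moment q (G * X ^ l) = 0)
    (hD : (Matrix.of fun α β : Fin G.natDegree => q ((α : ℕ) + β)).det ≠ 0) :
    G.natDegree * x + 2 * (k + 1) / t * height w ξ G ≤
      drop w ξ (Real.exp (-((k + 1) * x / t) / w.weight)) G + dropConst K n A := by
  set r := G.natDegree with hrdef
  obtain ⟨L, hL⟩ : ∃ L, r + L = n - k + 2 := ⟨n - k + 2 - r, by omega⟩
  set D := (Matrix.of fun α β : Fin r => q ((α : ℕ) + β)).det with hDdef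
  have hA0 : 0 < A := by linarith
  have hlA : 0 ≤ Real.log A := Real.log_nonneg hA
  have hw := w.weight_pos
  have ht0 : (0 : ℝ) < t := by exact_mod_cast ht
  have hκ0 := threshold_pos n (n + 1)
  have hκ1 := log_threshold_nonpos n (n + 1)
  have hn1 : 1 ≤ n := by omega
  have hlf0 := log_factorial_nonneg n
  have hlf : Real.log r.factorial ≤ Real.log n.factorial :=
    Real.log_le_log (by exact_mod_cast r.factorial_pos)
      (by exact_mod_cast Nat.factorial_le (by omega))
  have hrn : (r : ℝ) ≤ n := by exact_mod_cast (by omega : r ≤ n)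
  have hrA : (r : ℝ) * Real.log A ≤ n * Real.log A := by gcongr
  have hlead : G.leadingCoeff ≠ 0 := leadingCoeff_ne_zero.2 hG0
  have hleadv : ∀ v : Place K, (locPoly w ξ v G).leadingCoeff =
      algebraMap K v.Completion G.leadingCoeff := fun v => by
    rw [leadingCoeff, natDegree_locPoly, coeff_natDegree_locPoly]
  have hleadpos : ∀ v : Place K, 0 < ‖algebraMap K v.Completion G.leadingCoeff‖ := fun v => by
    rw [norm_pos_iff, Ne, map_eq_zero]; exact hlead
  have hDpos : ∀ v : Place K, 0 < ‖algebraMap K v.Completion D‖ := fun v => by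
    rw [norm_pos_iff, Ne, map_eq_zero]; exact hD
  have hSpos : ∀ v : Place K, 0 < gaussN 1 (locPoly w ξ v G) := fun v =>
    gaussN_pos one_pos (locPoly_ne_zero w ξ v hG0)
  have sD := Place.support_log_norm_algebraMap hD
  have sG : (fun v => L * logNorm w ξ v G).support.Finite :=
    (support_logNorm w ξ hG0).subset fun v hv h => hv (by simp only [h, mul_zero])
  have sl : (fun v : Place K => L * (v.weight *
      Real.log ‖algebraMap K v.Completion G.leadingCoeff‖)).support.Finite :=
    (Place.support_log_norm_algebraMap hlead).subset fun v hv h =>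
      hv (by simp only [h, mul_zero])
  have s1 := (sD.union sG).subset (Function.support_add _ _)
  have key := Place.finsum_le_of_le w (fun v => v.weight * Real.log ‖algebraMap K v.Completion D‖ +
      L * logNorm w ξ v G -
      L * (v.weight * Real.log ‖algebraMap K v.Completion G.leadingCoeff‖))
    ((s1.union sl).subset (Function.support_sub _ _))
    (C := 2 * (Real.log n.factorial + n * Real.log A - Real.log (threshold n (n + 1))))
    (B := t * drop w ξ (Real.exp (-((k + 1) * x / t) / w.weight)) G - t * r * x +
      2 * (n * Real.log A + hankelConst n))
    (by nlinarith) ?_ ?_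
  · rw [finsum_sub_distrib s1 sl, finsum_add_distrib sD sG,
      Place.finsum_log_norm_algebraMap hD, ← mul_finsum, ← mul_finsum,
      Place.finsum_log_norm_algebraMap hlead] at key
    change 0 + L * height w ξ G - _ ≤ _ at key
    have hh := height_nonneg w ξ hG0
    -- Here 4k ≤ n is decisive: L = n - k + 2 - r ≥ n - 2k + 2 ≥ 2(k + 1).
    have hL2 : (2 * (k + 1) : ℝ) ≤ L := by exact_mod_cast (by omega : 2 * (k + 1) ≤ L)
    have hC0 : 0 ≤ dropConst K n A := by
      have := hankelConst_nonneg n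
      rw [dropConst]
      have : 0 ≤ Real.log n.factorial + n * Real.log A - Real.log (threshold n (n + 1)) := by
        nlinarith [n.cast_nonneg (α := ℝ)]
      positivity
    have ht1 : (1 : ℝ) ≤ t := by exact_mod_cast ht
    have h1 : t * (r * x + 2 * (k + 1) / t * height w ξ G) ≤
        t * (drop w ξ (Real.exp (-((k + 1) * x / t) / w.weight)) G + dropConst K n A) := by
      have e1 : t * (r * x + 2 * (k + 1) / t * height w ξ G) =
          t * r * x + 2 * (k + 1) * height w ξ G := by field_simp
      have e2 : 2 * (k + 1) * height w ξ G ≤ L * height w ξ G := by gcongr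
      have e3 : dropConst K n A ≤ t * dropConst K n A := le_mul_of_one_le_left hC0 ht1
      rw [e1]
      rw [dropConst] at e3 ⊢
      linarith
    exact le_of_mul_le_mul_left h1 ht0
  · intro v hv
    cases v with
    | arch v =>
      have h1 := norm_hankel_mul_pow_le n hn1 (locMoment w ξ (Place.arch v) q)
        (locPoly w ξ (Place.arch v) G) (locPoly_ne_zero w ξ _ hG0) (n - k) L
        (by rw [natDegree_locPoly]; omega) (by omega) (by rw [natDegree_locPoly]; omega)
        (locMoment_recurrence w ξ _ q G hG)
        (A := A) (fun l hl => by rw [locMoment_of_ne w ξ hv]; exact h.arch v hv l hl)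
      rw [hleadv, natDegree_locPoly, ← hrdef, ← algebraMap_hankel, ← hDdef] at h1
      have hfac : (0 : ℝ) < r.factorial := by exact_mod_cast r.factorial_pos
      have p1 := hDpos (Place.arch v)
      have p2 := hSpos (Place.arch v)
      have p3 := hleadpos (Place.arch v)
      have h2 := Real.log_le_log (by positivity) h1
      rw [Real.log_mul p1.ne' (by positivity), Real.log_mul hκ0.ne' (by positivity), Real.log_pow,
        Real.log_mul (by positivity) (by positivity), Real.log_pow,
        Real.log_mul hfac.ne' (by positivity), Real.log_pow] at h2
      simp only [logNorm, Place.archConst]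
      have h3 : (Place.arch v).weight * (Real.log ‖algebraMap K (Place.arch v).Completion D‖ +
          L * Real.log (gaussN 1 (locPoly w ξ (Place.arch v) G)) -
          L * Real.log ‖algebraMap K (Place.arch v).Completion G.leadingCoeff‖) ≤
          (Place.arch v).weight *
            (Real.log n.factorial + n * Real.log A - Real.log (threshold n (n + 1))) :=
        mul_le_mul_of_nonneg_left (by linarith) (Place.weight_pos _).le
      have h4 : (Place.arch v).weight *
            (Real.log n.factorial + n * Real.log A - Real.log (threshold n (n + 1))) ≤
          2 * (Real.log n.factorial + n * Real.log A - Real.log (threshold n (n + 1))) :=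
        mul_le_mul_of_nonneg_right (Place.weight_le_two _)
          (by nlinarith [n.cast_nonneg (α := ℝ)])
      linarith
    | ultra v =>
      have h1 := norm_hankel_mul_pow_le_of_ultrametric n (locMoment w ξ (Place.ultra v) q)
        (locPoly w ξ (Place.ultra v) G) (locPoly_ne_zero w ξ _ hG0) (n - k) L
        (by rw [natDegree_locPoly]; omega) (by rw [natDegree_locPoly]; omega)
        (locMoment_recurrence w ξ _ q G hG)
        (fun l hl => by rw [locMoment_of_ne w ξ hv]; exact h.ultra v hv l hl)
      rw [hleadv, natDegree_locPoly, ← hrdef, ← algebraMap_hankel, ← hDdef] at h1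
      have p1 := hDpos (Place.ultra v)
      have p2 := hSpos (Place.ultra v)
      have p3 := hleadpos (Place.ultra v)
      have h2 := Real.log_le_log (by positivity) h1
      rw [Real.log_mul p1.ne' (by positivity), Real.log_pow, Real.log_pow] at h2
      simp only [logNorm, Place.archConst, Place.weight, one_mul]
      linarith
  -- The logarithmic gap (k+1)x/`w.weight` between large and small moments, divided by t, determines
  -- the radius.
  · have hYZ : Real.log (A * Real.exp ((k + 1 - t) * x / w.weight)) =
        Real.log (A * Real.exp (-(t * x) / w.weight)) + t * ((k + 1) * x / t / w.weight) := by
      rw [Real.log_mul hA0.ne' (by positivity), Real.log_mul hA0.ne' (by positivity),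
        Real.log_exp, Real.log_exp]
      field_simp; ring
    have h1 := log_norm_hankel_le n hn1 (locMoment w ξ w q)
      (locPoly w ξ w G) (locPoly_ne_zero w ξ _ hG0) (n - k) L t
      (by rw [natDegree_locPoly]; omega) (by omega) (by omega) (by rw [natDegree_locPoly]; omega)
      (locMoment_recurrence w ξ _ q G hG) (by positivity) (by positivity) (by positivity) hYZ
      h.big h.small (by
        rw [natDegree_locPoly, ← hrdef, ← algebraMap_hankel, Ne, map_eq_zero]; exact hD)
    rw [hleadv, natDegree_locPoly, ← hrdef, ← algebraMap_hankel, ← hDdef, ← neg_div] at h1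
    have h2 := mul_le_mul_of_nonneg_left h1 hw.le
    have hH : w.weight * hankelConst n ≤ 2 * hankelConst n :=
      mul_le_mul_of_nonneg_right w.weight_le_two (hankelConst_nonneg n)
    have hZ : w.weight * (r * Real.log (A * Real.exp (-(t * x) / w.weight))) ≤
        2 * (n * Real.log A) - t * r * x := by
      rw [Real.log_mul hA0.ne' (by positivity), Real.log_exp]
      have e1 : w.weight * (r * (Real.log A + -(t * x) / w.weight)) =
          w.weight * (r * Real.log A) - t * r * x := by field_simp; ring
      rw [e1]
      have : w.weight * (r * Real.log A) ≤ 2 * (n * Real.log A) :=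
        mul_le_mul w.weight_le_two hrA (by positivity) zero_le_two
      linarith
    simp only [logNorm, drop]
    linarith

end SmallMoments

/-! ### Approximation by conjugates -/

section Main

variable {K : Type u} [Field K] [NumberField K] (w : Place K) (ξ : w.Completion)

theorem Place.normExponent_pos (v : Place K) : 0 < v.normExponent := by
  rw [Place.normExponent_eq]
  exact div_pos v.weight_pos (by exact_mod_cast Module.finrank_pos)

theorem Place.norm_le_exp_of_abv_le {v : Place K} {x : v.Completion} {a : ℝ}
    (h : v.abv x ≤ Real.exp a) : ‖x‖ ≤ Real.exp (a / v.normExponent) := by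
  have he := v.normExponent_pos
  by_contra hlt
  push Not at hlt
  have h1 := Real.rpow_lt_rpow (Real.exp_pos _).le hlt he
  rw [← Real.exp_mul, div_mul_cancel₀ _ he.ne'] at h1
  exact absurd h (not_le.2 h1)

theorem Place.norm_coeff_le_one {v : Place K} {Q : K[X]} (h : v.coeffNorm Q ≤ 1) (i : ℕ) :
    ‖algebraMap K v.Completion (Q.coeff i)‖ ≤ 1 := by
  by_cases hi : i < Q.natDegree + 1
  · have h1 : v.abv (algebraMap K v.Completion (Q.coeff i)) ≤ 1 :=
      (Finset.le_sup' (fun i => v.abv (algebraMap K v.Completion (Q.coeff i)))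
        (Finset.mem_range.2 hi)).trans h
    have := Place.norm_le_exp_of_abv_le (a := 0) (by rwa [Real.exp_zero])
    rwa [zero_div, Real.exp_zero] at this
  · rw [coeff_eq_zero_of_natDegree_lt (by omega), map_zero, norm_zero]
    exact zero_le_one

theorem norm_natCast_le_cast {F : Type*} [NormedField F] (m : ℕ) : ‖(m : F)‖ ≤ m := by
  simpa using Nat.norm_cast_le (α := F) m

/-- Away from w the factorials cost at most (n!)² at Archimedean places and nothing at ultrametric
ones. Dividing by `normExponent` undoes the normalization of the absolute value. -/
theorem smallMoments_dualSeq {n t : ℕ} (htn : t ≤ n) {Q : K[X]} (hQ : Q.natDegree ≤ n)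
    (hv : ∀ v ≠ w, v.coeffNorm Q ≤ 1) {y z : ℝ}
    (hs : ∀ j ≤ n - t, w.abv (aeval ξ (derivative^[j] Q)) ≤ Real.exp z)
    (hb : ∀ j, n - t < j → j ≤ n → w.abv (aeval ξ (derivative^[j] Q)) ≤ Real.exp y) :
    SmallMoments w ξ n t (n.factorial ^ 2) (n.factorial ^ 2 * Real.exp (y / w.normExponent))
      (n.factorial ^ 2 * Real.exp (z / w.normExponent)) (dualSeq n Q) := by
  have hfac : ∀ m ≤ n, (m.factorial : ℝ) ≤ n.factorial := fun m hm => by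
    exact_mod_cast Nat.factorial_le hm
  have hfac1 : (1 : ℝ) ≤ n.factorial := by exact_mod_cast n.factorial_pos
  have hmom : ∀ l ≤ n, ‖locMoment w ξ w (dualSeq n Q) l‖ ≤
      n.factorial ^ 2 * ‖aeval ξ (derivative^[n - l] Q)‖ := by
    intro l hl
    have h1 : locMoment w ξ w (dualSeq n Q) l = (-1) ^ l * l.factorial *
        aeval ξ (derivative^[n - l] Q) := by
      have := moment_dualSeq n (Q.map (algebraMap K w.Completion)) (by rwa [natDegree_map]) ξ hl
      rw [iterate_derivative_map, eval_map_algebraMap] at this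
      rw [← this, locMoment, center_self]
      congr 2
      funext l
      exact (dualSeq_map _ n Q l).symm
    rw [h1, norm_mul, norm_mul, norm_pow, norm_neg, norm_one, one_pow, one_mul]
    refine mul_le_mul_of_nonneg_right ?_ (norm_nonneg _)
    have := norm_natCast_le_cast (F := w.Completion) l.factorial
    have := hfac l hl
    nlinarith
  have hglob : ∀ (v : Place K) (l : ℕ), ‖algebraMap K v.Completion (dualSeq n Q l)‖ =
      ‖(l.factorial : v.Completion)‖ * ‖((n - l).factorial : v.Completion)‖ *
        ‖algebraMap K v.Completion (Q.coeff (n - l))‖ := by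
    intro v l
    simp [dualSeq]
  refine ⟨fun v hvw l hl => ?_, fun v hvw l hl => ?_, fun l hl => ?_, fun l hl hln => ?_⟩
  · rw [hglob]
    have h1 := (norm_natCast_le_cast (F := (Place.arch v).Completion) l.factorial).trans (hfac l hl)
    have h2 := (norm_natCast_le_cast (F := (Place.arch v).Completion) (n - l).factorial).trans
      (hfac _ (Nat.sub_le _ _))
    have h3 := Place.norm_coeff_le_one (hv _ hvw) (n - l)
    calc _ ≤ (n.factorial : ℝ) * n.factorial * 1 := by gcongr
      _ = _ := by ring
  · rw [hglob]
    have h1 := IsUltrametricDist.norm_natCast_le_one (Place.ultra v).Completion l.factorial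
    have h2 := IsUltrametricDist.norm_natCast_le_one (Place.ultra v).Completion (n - l).factorial
    have h3 := Place.norm_coeff_le_one (hv _ hvw) (n - l)
    exact mul_le_one₀ (mul_le_one₀ h1 (norm_nonneg _) h2) (norm_nonneg _) h3
  · refine (hmom l (by omega)).trans (mul_le_mul_of_nonneg_left ?_ (by positivity))
    exact Place.norm_le_exp_of_abv_le (hb _ (by omega) (by omega))
  · refine (hmom l hln).trans (mul_le_mul_of_nonneg_left ?_ (by positivity))
    exact Place.norm_le_exp_of_abv_le (hs _ (by omega))

theorem exists_dualSeq_ne_zero {n : ℕ} {Q : K[X]} (hQ0 : Q ≠ 0) (hQ : Q.natDegree ≤ n) :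
    ∃ l ≤ n, dualSeq n Q l ≠ 0 := by
  refine ⟨n - Q.natDegree, Nat.sub_le _ _, ?_⟩
  have h2 : n - (n - Q.natDegree) = Q.natDegree := by omega
  rw [dualSeq, h2]
  simp [hQ0, Nat.factorial_ne_zero]

/-- The radius of the disk around `ξ` used at the scale `x`. -/
noncomputable def radius (k t : ℕ) (x : ℝ) : ℝ :=
  Real.exp (-((k + 1) * x / t) / w.weight)

theorem radius_pos (k t : ℕ) (x : ℝ) : 0 < radius w k t x := Real.exp_pos _

theorem radius_anti (k t : ℕ) {x y : ℝ} (h : x ≤ y) : radius w k t y ≤ radius w k t x := by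
  have := w.weight_pos
  rw [radius, radius]
  gcongr

/-- The irreducible polynomial `p` has a root very close to `ξ` at the scale `x`. -/
def IsClose (k t : ℕ) (B x : ℝ) (p : K[X]) : Prop :=
  Irreducible p ∧ p.natDegree ≤ k ∧
    p.natDegree * x + 2 * (k + 1) / t * height w ξ p ≤ drop w ξ (radius w k t x) p + B

/-- The constant in `exists_isClose`. -/
noncomputable def closeConst (K : Type u) [Field K] [NumberField K] (n k t : ℕ) (A : ℝ) : ℝ :=
  2 * gaussConst k + 2 * (k + 1) / t *
    ((Fintype.card (NumberField.InfinitePlace K) + 1) * gaussConst k) + dropConst K n A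

theorem dropConst_nonneg (n : ℕ) {A : ℝ} (hA : 1 ≤ A) : 0 ≤ dropConst K n A := by
  have h1 := hankelConst_nonneg n
  have h2 := log_threshold_nonpos n (n + 1)
  have h3 := log_factorial_nonneg n
  have h4 := Real.log_nonneg hA
  have : 0 ≤ Real.log n.factorial + n * Real.log A - Real.log (threshold n (n + 1)) := by
    nlinarith [n.cast_nonneg (α := ℝ)]
  rw [dropConst]
  positivity

variable {w ξ}

/-- The drop is almost subadditive, the degree additive and the height almost superadditive, so
`exists_irreducible_dvd` applies to their combination in `IsClose`. -/
theorem SmallMoments.exists_isClose {n k t : ℕ} {A x γ : ℝ} {q : ℕ → K} (hA : 1 ≤ A)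
    (hx : 0 ≤ x) (ht : 1 ≤ t) (htk : t ≤ k) (hkn : 4 * k ≤ n) (hγ : minorConst w ξ n A < γ)
    (hγ0 : 0 ≤ γ)
    (h : SmallMoments w ξ n t A (A * Real.exp ((k + 1 - t) * x / w.weight))
      (A * Real.exp (-(t * x + γ) / w.weight)) q) (hq : ∃ l ≤ n, q l ≠ 0) :
    ∃ p, IsClose w ξ k t (closeConst K n k t A) x p := by
  obtain ⟨G, hG0, hr, hGk, hG, hD⟩ := h.exists_recurrence hA hx htk hkn hγ hq
  have h' : SmallMoments w ξ n t A (A * Real.exp ((k + 1 - t) * x / w.weight))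
      (A * Real.exp (-(t * x) / w.weight)) q :=
    { arch := h.arch
      ultra := h.ultra
      big := h.big
      small := fun l h1 h2 => (h.small l h1 h2).trans (by
        have := w.weight_pos
        gcongr
        linarith) }
  have hdrop := h'.le_drop hA hx ht htk hkn G hG0 hr hGk hG hD
  have hgc := gaussConst_nonneg k
  have hdc := dropConst_nonneg (K := K) n hA
  have hcc : dropConst K n A ≤ closeConst K n k t A := by
    rw [closeConst]
    have : 0 ≤ 2 * gaussConst k + 2 * (k + 1) / t *
      ((Fintype.card (NumberField.InfinitePlace K) + 1) * gaussConst k) := by positivity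
    linarith
  obtain ⟨p, hp, hpG, hpΦ⟩ := exists_irreducible_dvd (fun P : K[X] =>
      drop w ξ (radius w k t x) P - P.natDegree * x - 2 * (k + 1) / t * height w ξ P) k
    (closeConst K n k t A) (fun P Q hP hQ hPQ => by
      have h1 := drop_mul_le w ξ k (radius_pos w k t x) hP hQ hPQ
      have h2 := height_mul_ge w ξ k hP hQ hPQ
      have h3 : (2 * (k + 1) / t : ℝ) * (height w ξ P + height w ξ Q) ≤
        2 * (k + 1) / t * (height w ξ (P * Q) +
          (Fintype.card (NumberField.InfinitePlace K) + 1) * gaussConst k) :=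
        mul_le_mul_of_nonneg_left h2 (by positivity)
      rw [natDegree_mul hP hQ, closeConst]
      push_cast
      linarith) G hr hGk (by
      rw [radius]
      linarith)
  refine ⟨p, hp, (natDegree_le_of_dvd hpG hG0).trans hGk, ?_⟩
  linarith

/-- Here β = 2(k+1)/t and V = βx/2. In the product of the lower bounds ex/2 + βh and e'x/2 + βh',
the cross terms are (βx/2)(eh' + e'h), exactly the height terms of the resultant bound. What remains
gives x²/4 ≤ βxC/2, against 2βC < x. -/
theorem real_contradiction {x B C β M M' h h' e e' : ℝ} (hx : 0 < x) (hB : 2 * B ≤ x) (hB0 : 0 ≤ B)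
    (hβ : 0 < β) (hC : 2 * β * C < x) (hh : 0 ≤ h) (hh' : 0 ≤ h') (he : 1 ≤ e) (he' : 1 ≤ e')
    (hM : e * x + β * h ≤ M + B) (hM' : e' * x + β * h' ≤ M' + B)
    (hMM : M * M' / (β * x / 2) ≤ e' * h + e * h' + C) : False := by
  rw [div_le_iff₀ (by positivity)] at hMM
  have h1 : e * (x / 2) ≤ e * x - B := by nlinarith
  have h2 : e' * (x / 2) ≤ e' * x - B := by nlinarith
  have h3 : (e * (x / 2) + β * h) * (e' * (x / 2) + β * h') ≤ M * M' :=
    mul_le_mul (by linarith) (by linarith) (by positivity) (by nlinarith [mul_nonneg hβ.le hh])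
  have h4 : 1 ≤ e * e' := one_le_mul_of_one_le_of_one_le he he'
  have h5 : 0 ≤ β * h * (β * h') := by positivity
  have h6 : (x / 2) * (x / 2) ≤ e * e' * ((x / 2) * (x / 2)) :=
    le_mul_of_one_le_left (by positivity) h4
  nlinarith

theorem associated_of_isClose {k t : ℕ} {B x : ℝ} (ht : 1 ≤ t) {p p' : K[X]}
    (hx : 0 < x) (hB : 2 * B ≤ x) (hB0 : 0 ≤ B)
    (hxC : 2 * (2 * (k + 1) / t) * ((Fintype.card (NumberField.InfinitePlace K) + 1) *
      (2 * Real.log (k + k).factorial)) < x)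
    (hp : IsClose w ξ k t B x p) (hp' : IsClose w ξ k t B x p') : Associated p p' := by
  by_contra hass
  have ht0 : (0 : ℝ) < t := by exact_mod_cast ht
  have hcop : IsCoprime p p' := by
    refine (hp.1.coprime_iff_not_dvd).2 fun hdvd => hass (hp.1.associated_of_dvd hp'.1 hdvd)
  have hp0 := hp.1.ne_zero
  have hp0' := hp'.1.ne_zero
  have h := drop_mul_drop_le w ξ k (V := (k + 1) * x / t) (by positivity) hp0 hp0' hp.2.1 hp'.2.1
    hcop
  refine real_contradiction (β := 2 * (k + 1) / t) hx hB hB0 (by positivity) hxC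
    (height_nonneg w ξ hp0) (height_nonneg w ξ hp0')
    (by exact_mod_cast hp.1.natDegree_pos) (by exact_mod_cast hp'.1.natDegree_pos)
    hp.2.2 hp'.2.2 ?_
  refine le_trans (le_of_eq ?_) h
  rw [radius]
  congr 1
  field_simp

/-- A larger scale shrinks the disk and so increases the drop; only the degree term is lost. This
brings the polynomials of consecutive scales to a common one. -/
theorem IsClose.mono {k t : ℕ} {B x y : ℝ} {p : K[X]} (hp : IsClose w ξ k t B x p) (hxy : x ≤ y) :
    IsClose w ξ k t (B + k * (y - x)) y p := by
  refine ⟨hp.1, hp.2.1, ?_⟩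
  have h1 := drop_anti w ξ (radius_pos w k t y) (radius_anti w k t hxy) hp.1.ne_zero
  have h2 := hp.2.2
  have h3 : (p.natDegree : ℝ) * (y - x) ≤ k * (y - x) :=
    mul_le_mul_of_nonneg_right (by exact_mod_cast hp.2.1) (by linarith)
  linarith

theorem drop_eq_of_associated {ρ : ℝ} (hρ : 0 < ρ) {p p' : K[X]} (hp : p ≠ 0)
    (h : Associated p p') : drop w ξ ρ p' = drop w ξ ρ p := by
  obtain ⟨u, rfl⟩ := h
  obtain ⟨a, ha, hau⟩ := Polynomial.isUnit_iff.1 u.isUnit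
  rw [← hau, mul_comm, drop_C_mul w ξ hρ ha.ne_zero hp]

/-- If there are close polynomials at all large scales, then one of them is close at all large
scales. -/
theorem exists_forall_drop_ge {k t : ℕ} (ht : 1 ≤ t) {B : ℝ} (hB : 0 ≤ B) {N₀ : ℕ}
    (h : ∀ N : ℕ, N₀ ≤ N → ∃ p, IsClose w ξ k t B N p) :
    ∃ (p : K[X]) (N₁ : ℕ), Irreducible p ∧
      ∀ N : ℕ, N₁ ≤ N → p.natDegree * (N : ℝ) ≤ drop w ξ (radius w k t N) p + B := by
  choose! p hp using h
  -- From N' on, `associated_of_isClose` applies with B + k; the extra k is the loss from N to N +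
  -- 1.
  obtain ⟨N', hN'⟩ := exists_nat_gt (max (2 * (B + k)) (2 * (2 * (k + 1) / t) *
    ((Fintype.card (NumberField.InfinitePlace K) + 1) * (2 * Real.log (k + k).factorial))))
  set N₁ := max N₀ N'
  have hstep : ∀ N, N₁ ≤ N → Associated (p N) (p (N + 1)) := by
    intro N hN
    have hNN : (N' : ℝ) ≤ (N + 1 : ℕ) := by exact_mod_cast (by omega : N' ≤ N + 1)
    have h1 := (hp N (by omega)).mono (y := (N + 1 : ℕ)) (by push_cast; linarith)
    have h2 := hp (N + 1) (by omega)
    have e1 : B + k * (((N + 1 : ℕ) : ℝ) - N) = B + k := by push_cast; ring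
    rw [e1] at h1
    refine associated_of_isClose ht (B := B + k) (x := (N + 1 : ℕ)) (by positivity)
      ((le_max_left _ _).trans (hN'.le.trans hNN)) (by positivity)
      (((le_max_right _ _).trans_lt hN').trans_le hNN) h1 ⟨h2.1, h2.2.1, ?_⟩
    exact h2.2.2.trans (by linarith [k.cast_nonneg (α := ℝ)])
  have hall : ∀ N, N₁ ≤ N → Associated (p N₁) (p N) := by
    intro N hN
    induction N, hN using Nat.le_induction with
    | base => exact Associated.refl _
    | succ N hN ih => exact ih.trans (hstep N hN)
  have hirr := (hp N₁ (by omega)).1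
  refine ⟨p N₁, N₁, hirr, fun N hN => ?_⟩
  have h1 := (hp N (by omega))
  have h2 := height_nonneg w ξ h1.1.ne_zero
  have h3 := drop_eq_of_associated (w := w) (ξ := ξ) (radius_pos w k t N) hirr.ne_zero (hall N hN)
  have h4 : (p N).natDegree = (p N₁).natDegree :=
    (natDegree_eq_of_degree_eq (degree_eq_degree_of_associated (hall N hN))).symm
  have h5 := h1.2.2
  rw [h3, h4] at h5
  have : 0 ≤ 2 * ((k : ℝ) + 1) / t * height w ξ (p N) := by positivity
  linarith

theorem le_of_forall_mul_le {a b C : ℝ} {N₁ : ℕ} (h : ∀ N : ℕ, N₁ ≤ N → a * N ≤ b * N + C) :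
    a ≤ b := by
  by_contra hlt
  push Not at hlt
  obtain ⟨N, hN⟩ := exists_nat_gt (C / (a - b))
  rw [div_lt_iff₀ (by linarith)] at hN
  have h1 := h (max N N₁) (le_max_right _ _)
  have h2 : (N : ℝ) ≤ (max N N₁ : ℕ) := by exact_mod_cast le_max_left _ _
  nlinarith

/-- If the j-th Taylor coefficient of p at ξ is nonzero, the drop is at most jV + O(1) with V =
(k+1)N/t. For j = 0 this contradicts the growth of the drop, so ξ is a root. Irreducible polynomials
are separable here, so j = 1 is allowed and bounds the degree. -/
theorem isAlgebraic_of_drop_ge {k t : ℕ} {B : ℝ} {p : K[X]} {N₁ : ℕ} (hp : Irreducible p)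
    (h : ∀ N : ℕ, N₁ ≤ N → p.natDegree * (N : ℝ) ≤ drop w ξ (radius w k t N) p + B) :
    IsAlgebraic K ξ ∧ ((minpoly K ξ).natDegree : ℝ) ≤ (k + 1) / t := by
  have hpos : (0 : ℝ) < p.natDegree := by exact_mod_cast hp.natDegree_pos
  have hroot : aeval ξ p = 0 := by
    by_contra h0
    have hc : (locPoly w ξ w p).coeff 0 ≠ 0 := by
      rw [locPoly_self, taylor_coeff_zero, eval_map_algebraMap]; exact h0
    have := le_of_forall_mul_le (a := p.natDegree) (b := 0) (fun N hN => by
      have h1 := h N hN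
      have h2 := drop_le_of_coeff w ξ ((k + 1) * N / t) 0 hc
      rw [Nat.cast_zero, zero_mul, zero_add] at h2
      rw [zero_mul, zero_add]
      exact h1.trans (add_le_add_left h2 B))
    linarith
  have hsep : aeval ξ (derivative p) ≠ 0 :=
    hp.separable.aeval_derivative_ne_zero hroot
  have hc : (locPoly w ξ w p).coeff 1 ≠ 0 := by
    rw [locPoly_self, taylor_coeff_one, derivative_map, eval_map_algebraMap]; exact hsep
  have hle := le_of_forall_mul_le (a := p.natDegree) (b := (k + 1) / t) (fun N hN => by
      have h1 := h N hN
      have h2 := drop_le_of_coeff w ξ ((k + 1) * N / t) 1 hc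
      rw [Nat.cast_one, one_mul] at h2
      have e : ((k : ℝ) + 1) / t * N = (k + 1) * N / t := by ring
      rw [e]
      exact (h1.trans (add_le_add_left h2 B)).trans_eq (add_assoc _ _ _))
  refine ⟨⟨p, hp.ne_zero, hroot⟩, le_trans ?_ hle⟩
  exact_mod_cast natDegree_le_of_dvd (minpoly.dvd K ξ hroot) hp.ne_zero

end Main

end RoyWaldschmidt

/-! ### The main theorem. -/

theorem theoremB {K : Type*} [Field K] [NumberField K]
    (n : ℕ) (w : RoyWaldschmidt.Place K) (ξ : w.Completion) :
    ∃ c : ℝ, 0 < c ∧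
      ∀ t k : ℕ, 1 ≤ t → (t : ℝ) ≤ (n : ℝ) / 4 → k = n / 4 →
        (∃ X₀ : ℝ, ∀ X : ℝ, X₀ ≤ X →
          ∃ Q : Polynomial K, Q ≠ 0 ∧ Q.natDegree ≤ n ∧
            (∀ v : RoyWaldschmidt.Place K, v ≠ w → v.coeffNorm Q ≤ 1) ∧
            (∀ j : ℕ, j ≤ n - t →
              w.abv (Polynomial.aeval ξ (Polynomial.derivative^[j] Q)) ≤
                c * X ^ (-(t : ℝ) / ((k : ℝ) + 1 - (t : ℝ)))) ∧
            (∀ j : ℕ, n - t < j → j ≤ n →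
              w.abv (Polynomial.aeval ξ (Polynomial.derivative^[j] Q)) ≤ X)) →
        IsAlgebraic K ξ ∧
          ((minpoly K ξ).natDegree : ℝ) ≤ ((n : ℝ) - (k : ℝ) + 1) / (2 * (t : ℝ)) := by
  set A : ℝ := n.factorial ^ 2
  -- Both nonnegative and larger than `minorConst`, and independent of t, as c = exp(-γ/d) has to
  -- be.
  set γ : ℝ := |RoyWaldschmidt.minorConst w ξ n A| + 1
  have hA : 1 ≤ A := one_le_pow₀ (by exact_mod_cast n.factorial_pos)
  have hγ0 : 0 ≤ γ := by positivity
  have hγ : RoyWaldschmidt.minorConst w ξ n A < γ := (le_abs_self _).trans_lt (lt_add_one _)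
  have hd : (0 : ℝ) < Module.finrank ℚ K := by exact_mod_cast Module.finrank_pos
  have hw := w.weight_pos
  refine ⟨Real.exp (-γ / Module.finrank ℚ K), Real.exp_pos _, fun t k ht htn hk hyp => ?_⟩
  have h4t : 4 * t ≤ n := by
    have : (4 * t : ℝ) ≤ n := by linarith
    exact_mod_cast this
  have htk : t ≤ k := by omega
  have hkn : 4 * k ≤ n := by omega
  have htk' : (t : ℝ) ≤ k := by exact_mod_cast htk
  have hs : (0 : ℝ) < k + 1 - t := by linarith
  obtain ⟨X₀, hX₀⟩ := hyp
  obtain ⟨N₀, hN₀⟩ := exists_nat_ge (X₀ * Module.finrank ℚ K / (k + 1 - t))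
  have hclose : ∀ N : ℕ, N₀ ≤ N → ∃ p, RoyWaldschmidt.IsClose w ξ k t
      (RoyWaldschmidt.closeConst K n k t A) N p := by
    intro N hN
    have hNN : (N₀ : ℝ) ≤ N := by exact_mod_cast hN
    -- At scale N, this X makes X^(-t/(k+1-t)) equal to exp(-tN/d).
    obtain ⟨Q, hQ0, hQn, hQv, hQs, hQb⟩ :=
      hX₀ (Real.exp ((k + 1 - t) * N / Module.finrank ℚ K)) (by
        refine le_trans ?_ (Real.add_one_le_exp _)
        have h1 := hN₀.trans hNN
        rw [div_le_iff₀ hs] at h1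
        have h2 : X₀ ≤ (k + 1 - t) * N / Module.finrank ℚ K := by
          rw [le_div_iff₀ hd]; linarith
        linarith)
    have e : Real.exp (-γ / Module.finrank ℚ K) * Real.exp ((k + 1 - t) * N / Module.finrank ℚ K) ^
        (-(t : ℝ) / ((k : ℝ) + 1 - (t : ℝ))) =
        Real.exp (-(t * N + γ) / Module.finrank ℚ K) := by
      rw [← Real.exp_mul, ← Real.exp_add]
      congr 1
      field_simp
      ring
    rw [e] at hQs
    have hsm := RoyWaldschmidt.smallMoments_dualSeq w ξ (t := t) (by omega) hQn hQv hQs hQb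
    rw [RoyWaldschmidt.Place.normExponent_eq, div_div_div_cancel_right₀ hd.ne',
      div_div_div_cancel_right₀ hd.ne'] at hsm
    exact hsm.exists_isClose hA N.cast_nonneg ht htk hkn hγ hγ0
      (RoyWaldschmidt.exists_dualSeq_ne_zero hQ0 hQn)
  have hcc : 0 ≤ RoyWaldschmidt.closeConst K n k t A := by
    have h1 := RoyWaldschmidt.gaussConst_nonneg k
    have h2 := RoyWaldschmidt.dropConst_nonneg (K := K) n hA
    rw [RoyWaldschmidt.closeConst]
    positivity
  obtain ⟨p, N₁, hp, hdrop⟩ := RoyWaldschmidt.exists_forall_drop_ge ht hcc hclose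
  obtain ⟨halg, hdeg⟩ := RoyWaldschmidt.isAlgebraic_of_drop_ge hp hdrop
  refine ⟨halg, hdeg.trans ?_⟩
  have ht0 : (0 : ℝ) < t := by exact_mod_cast ht
  have hkn' : (4 : ℝ) * k ≤ n := by exact_mod_cast hkn
  have hk1 : (1 : ℝ) ≤ k := by exact_mod_cast ht.trans htk
  -- What is needed is 2(k+1) ≤ n - k + 1, which follows from n ≥ 4k and k ≥ 1.
  rw [div_le_div_iff₀ ht0 (by positivity)]
  nlinarith
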